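/- There is an absolute constant $C>0$ such that the following holds. Let $G$ be an Abelian group, let $X\subset G$ be finite and non-empty, let $d\ge 0$ be real, and suppose that $X$ has relative polynomial growth of order $d$, that is, $|nX|\le n^d|X|$ for every integer $n\ge 1$, where $nX=X+\dots+X$ ($n$ summands). Then there are a natural number $k$ and a finite $k$-dimensional centred convex coset progression $M\subset G$ such that $$X-X\subset M,\qquad k\le C\,d\log^2(d+2),\qquad |M|\le \exp\bigl(C\,d\log^2(d+2)\bigr)\,|X|.$$ Here a $k$-dimensional centred convex coset progression is a set of the form $\phi(\mathbb{Z}^k\cap Q)+H$, where $Q\subset\mathbb{R}^k$ is a symmetric convex body (compact, convex, with non-empty interior, and $Q=-Q$), $\phi:\mathbb{Z}^k\to G$ is a homomorphism, and $H\le G$ is a subgroup. (For $d\ge 2$ the bounds are $O(d\log^2 d)$ and $\exp(O(d\log^2 d))|X|$.) -/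

import Mathlib

open scoped Pointwise

/-- The `n`-fold sumset `nX = X + ... + X`. -/
def iteratedSumset {G : Type*} [AddCommGroup G] (n : ℕ) (X : Set G) : Set G :=
  {x | ∃ f : Fin n → G, (∀ i, f i ∈ X) ∧ ∑ i, f i = x}

/-- `X` has relative polynomial growth of order `d`: `|nX| ≤ n ^ d |X|` for all integers `n ≥ 1`.
Used for finite sets `X`, for which every `nX` is finite and `Set.ncard` is its size. -/
def HasRelativePolynomialGrowth {G : Type*} [AddCommGroup G] (X : Set G) (d : ℝ) : Prop :=
  ∀ n : ℕ, 1 ≤ n → ((iteratedSumset n X).ncard : ℝ) ≤ (n : ℝ) ^ d * (X.ncard : ℝ)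

/-- `P` is a `k`-dimensional centred convex progression: the image of `ℤ ^ k ∩ Q` under a
homomorphism `φ : ℤ ^ k → G`, where `Q` is a symmetric convex body (compact, convex, with
non-empty interior, and `Q = -Q`) in `ℝ ^ k`. -/
def IsCentredConvexProgression {G : Type*} [AddCommGroup G] (k : ℕ) (P : Set G) : Prop :=
  ∃ (Q : ConvexBody (Fin k → ℝ)) (φ : (Fin k → ℤ) →+ G),
    (interior (Q : Set (Fin k → ℝ))).Nonempty ∧
    (∀ x : Fin k → ℝ, x ∈ Q → -x ∈ Q) ∧
    P = φ '' {z : Fin k → ℤ | (fun i => (z i : ℝ)) ∈ Q}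

/-- `M` is a `k`-dimensional centred convex coset progression: `M = P + H` with `P` a
`k`-dimensional centred convex progression and `H` a subgroup of `G`. -/
def IsCentredConvexCosetProgression {G : Type*} [AddCommGroup G] (k : ℕ) (M : Set G) : Prop :=
  ∃ (P : Set G) (H : AddSubgroup G), IsCentredConvexProgression k P ∧ M = P + (H : Set G)

/-! Fourier analysis suffices. Take an integer `N` with `d ≤ N`, a bounded distance above `d`.
Polynomial growth yields some `r ≤ N ^ 11` for which `A = rX` grows by a factor at most `1 + N⁻⁶` on
adding `X`. Characters in the large spectrum `Γ` of `A` are then within `O(N⁻⁶)` of `1` on `X - X`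
(`norm_addChar_sub_one_le`), while the set where they all have real part at least `1/2` has size at
most `16 N ^ (22 d) |X|` (`card_le_of_re_spectrum`).

Record elements of `G` with their angles in a subgroup of `ℝ ^ Γ × G`. If `23 N` independent angle
vectors had norm at most `N⁻⁶`, passing from radius `N⁻⁶` to `1/6` would multiply the Bohr set by `N
^ (23 N)` (`pow_mul_card_le_card`), contradicting that size bound. So the short angle vectors span
dimension `k < 23 N`. In a basis of maximal determinant their coordinates are at most `1`, so the
unit cube of `ℝ ^ k` captures `X - X` and still lies in the small Bohr set. The elements over that
cube form the progression, and the fibre over `0` is `H`.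

This needs `G` finite. Finitely generated groups follow by residual finiteness and an ultrafilter
limit of subgroups of `ℝ ^ k × G`, and general groups by passing to the subgroup generated by `X`.
For `d < 1/2`, where the bounds leave no room for constants, `X - X` is itself a subgroup. The
argument gives dimension `O(d)` and size `exp(O(d log(d + 2))) |X|`, which is stronger than
required. -/

/-! ### Large spectra and Bohr sets in finite groups. -/

section Fourier

open Finset

variable {G : Type*} [AddCommGroup G]

/-- The character sum of a finite set. -/
noncomputable def charSum (A : Finset G) (γ : AddChar G ℂ) : ℂ := ∑ a ∈ A, γ a

lemma addChar_sum_apply {ι : Type*} (γ : AddChar G ℂ) (s : Finset ι) (f : ι → G) :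
    γ (∑ i ∈ s, f i) = ∏ i ∈ s, γ (f i) := by
  classical
  induction s using Finset.induction_on with
  | empty => simp
  | insert a s ha ih => rw [Finset.sum_insert ha, Finset.prod_insert ha, γ.map_add_eq_mul, ih]

lemma sum_mem_card_nsmul [DecidableEq G] {A : Finset G} {l : ℕ} {p : Fin l → G}
    (hp : ∀ i, p i ∈ A) : ∑ i, p i ∈ l • A := by
  induction l with
  | zero => simp
  | succ l ih =>
    rw [Fin.sum_univ_castSucc, succ_nsmul]
    exact Finset.add_mem_add (ih fun i => hp _) (hp _)

lemma norm_charSum_le [Finite G] (A : Finset G) (γ : AddChar G ℂ) : ‖charSum A γ‖ ≤ #A := by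
  unfold charSum
  refine (norm_sum_le _ _).trans ?_
  simp [AddChar.norm_apply]

lemma conj_addChar_apply [Finite G] (γ : AddChar G ℂ) (b : G) :
    (starRingEnd ℂ) (γ b) = γ (-b) := by
  rw [AddChar.map_neg_eq_conj]

lemma sum_norm_charSum_sq [Fintype G] (A : Finset G) :
    ∑ γ : AddChar G ℂ, ‖charSum A γ‖ ^ 2 = Fintype.card G * #A := by
  classical
  have h : ∑ γ : AddChar G ℂ, charSum A γ * (starRingEnd ℂ) (charSum A γ)
      = (Fintype.card G * #A : ℂ) := by
    have h1 : ∀ γ : AddChar G ℂ, charSum A γ * (starRingEnd ℂ) (charSum A γ)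
        = ∑ a ∈ A, ∑ b ∈ A, γ (a - b) := by
      intro γ
      simp only [charSum, map_sum, Finset.sum_mul_sum, conj_addChar_apply, sub_eq_add_neg,
        AddChar.map_add_eq_mul]
    simp_rw [h1]
    rw [Finset.sum_comm]
    have h2 : ∀ a ∈ A, ∑ γ : AddChar G ℂ, ∑ b ∈ A, γ (a - b) = Fintype.card G := by
      intro a ha
      rw [Finset.sum_comm]
      simp_rw [AddChar.sum_apply_eq_ite, sub_eq_zero]
      simp [ha]
    rw [Finset.sum_congr rfl h2]
    simp [mul_comm]
  have h3 : ∀ γ : AddChar G ℂ, charSum A γ * (starRingEnd ℂ) (charSum A γ)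
      = ((‖charSum A γ‖ ^ 2 : ℝ) : ℂ) := by
    intro γ
    rw [Complex.mul_conj, Complex.normSq_eq_norm_sq]
  simp_rw [h3] at h
  exact_mod_cast h

/-- By orthogonality this counts pairs of an `l`-tuple from `A` and a point of `l • A` equal to its
sum; each tuple has exactly one such point. -/
lemma sum_charSum_pow_mul_conj [Fintype G] [DecidableEq G] (A : Finset G) (l : ℕ) :
    ∑ γ : AddChar G ℂ, charSum A γ ^ l * (starRingEnd ℂ) (charSum (l • A) γ)
      = (Fintype.card G * (#A : ℂ) ^ l) := by
  have h1 : ∀ γ : AddChar G ℂ, charSum A γ ^ l * (starRingEnd ℂ) (charSum (l • A) γ)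
      = ∑ p ∈ Fintype.piFinset (fun _ : Fin l => A), ∑ y ∈ l • A, γ (∑ i, p i - y) := by
    intro γ
    simp only [charSum, map_sum, Finset.sum_pow', Finset.sum_mul_sum, conj_addChar_apply,
      sub_eq_add_neg, AddChar.map_add_eq_mul, addChar_sum_apply]
  simp_rw [h1]
  rw [Finset.sum_comm]
  have h2 : ∀ p ∈ Fintype.piFinset (fun _ : Fin l => A),
      ∑ γ : AddChar G ℂ, ∑ y ∈ l • A, γ (∑ i, p i - y) = Fintype.card G := by
    intro p hp
    have hmem : ∑ i, p i ∈ l • A := sum_mem_card_nsmul (Fintype.mem_piFinset.1 hp)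
    rw [Finset.sum_comm]
    simp_rw [AddChar.sum_apply_eq_ite, sub_eq_zero]
    simp [hmem]
  rw [Finset.sum_congr rfl h2]
  simp [mul_comm]

lemma sum_norm_charSum_mul_le [Fintype G] (A B : Finset G) :
    ∑ γ : AddChar G ℂ, ‖charSum A γ‖ * ‖charSum B γ‖ ≤ Fintype.card G * √(#A * #B) := by
  refine (Real.sum_mul_le_sqrt_mul_sqrt _ _ _).trans ?_
  rw [sum_norm_charSum_sq, sum_norm_charSum_sq, ← Real.sqrt_mul (by positivity)]
  rw [show (Fintype.card G * #A * (Fintype.card G * #B) : ℝ)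
    = (Fintype.card G : ℝ) ^ 2 * (#A * #B) by ring, Real.sqrt_mul (by positivity),
    Real.sqrt_sq (by positivity)]

/-- A Bohr set whose frequencies include all the large spectrum of `A` is not much larger than
an iterated sumset of `A`. -/
lemma card_le_of_re_spectrum [Fintype G] [DecidableEq G] {A B : Finset G} {m : ℕ} (hA : A.Nonempty)
    (hm : 4 * (#((m + 1) • A) : ℝ) ≤ 4 ^ m * #A)
    (hB : ∀ γ : AddChar G ℂ, (#A : ℝ) ≤ 2 * ‖charSum A γ‖ → ∀ g ∈ B, 1 / 2 ≤ (γ g).re) :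
    (#B : ℝ) ≤ 16 * #((m + 1) • A) := by
  set Y := (m + 1) • A with hY
  have ha : (0 : ℝ) < #A := by exact_mod_cast hA.card_pos
  have hG : (0 : ℝ) < Fintype.card G := by exact_mod_cast Fintype.card_pos
  rcases B.eq_empty_or_nonempty with rfl | hBne
  · simp
  have hb : (0 : ℝ) < #B := by exact_mod_cast hBne.card_pos
  -- On the large spectrum the factor `2‖charSum B γ‖ / #B` is at least `1` and may be inserted; off
  -- it, `m` factors of `charSum A γ` each save a factor `2`.
  have hpt : ∀ γ : AddChar G ℂ, ‖charSum A γ ^ (m + 1) * (starRingEnd ℂ) (charSum Y γ)‖ ≤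
      (#A : ℝ) ^ (m + 1) * (2 / #B) * (‖charSum B γ‖ * ‖charSum Y γ‖) +
      (#A / 2 : ℝ) ^ m * (‖charSum A γ‖ * ‖charSum Y γ‖) := by
    intro γ
    rw [norm_mul, norm_pow, RCLike.norm_conj]
    by_cases h : (#A : ℝ) ≤ 2 * ‖charSum A γ‖
    · have h1 : (#B : ℝ) / 2 ≤ ‖charSum B γ‖ := by
        refine le_trans ?_ (Complex.re_le_norm _)
        rw [charSum, Complex.re_sum]
        calc (#B : ℝ) / 2 = ∑ g ∈ B, (1 / 2 : ℝ) := by simp; ring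
          _ ≤ _ := Finset.sum_le_sum (hB γ h)
      have h2 : 1 ≤ 2 / #B * ‖charSum B γ‖ := by
        rw [div_mul_eq_mul_div, le_div_iff₀ hb]; linarith
      have h3 : ‖charSum A γ‖ ^ (m + 1) ≤ (#A : ℝ) ^ (m + 1) := by
        gcongr; exact norm_charSum_le _ _
      calc ‖charSum A γ‖ ^ (m + 1) * ‖charSum Y γ‖
          ≤ (#A : ℝ) ^ (m + 1) * ‖charSum Y γ‖ * 1 := by rw [mul_one]; gcongr
        _ ≤ (#A : ℝ) ^ (m + 1) * ‖charSum Y γ‖ * (2 / #B * ‖charSum B γ‖) := by gcongr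
        _ = (#A : ℝ) ^ (m + 1) * (2 / #B) * (‖charSum B γ‖ * ‖charSum Y γ‖) := by ring
        _ ≤ _ := le_add_of_nonneg_right (by positivity)
    · have h3 : ‖charSum A γ‖ ^ m ≤ (#A / 2 : ℝ) ^ m := by
        gcongr; linarith
      calc ‖charSum A γ‖ ^ (m + 1) * ‖charSum Y γ‖
          = ‖charSum A γ‖ ^ m * (‖charSum A γ‖ * ‖charSum Y γ‖) := by ring
        _ ≤ (#A / 2 : ℝ) ^ m * (‖charSum A γ‖ * ‖charSum Y γ‖) := by gcongr
        _ ≤ _ := le_add_of_nonneg_left (by positivity)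
  have hsum : (Fintype.card G : ℝ) * (#A : ℝ) ^ (m + 1) ≤
      (#A : ℝ) ^ (m + 1) * (2 / #B) * (Fintype.card G * √(#B * #Y)) +
      (#A / 2 : ℝ) ^ m * (Fintype.card G * √(#A * #Y)) := by
    have h := sum_charSum_pow_mul_conj A (m + 1)
    have h' : (Fintype.card G : ℝ) * (#A : ℝ) ^ (m + 1) =
        ‖∑ γ : AddChar G ℂ, charSum A γ ^ (m + 1) * (starRingEnd ℂ) (charSum Y γ)‖ := by
      rw [h]; simp
    rw [h']
    refine (norm_sum_le _ _).trans ((Finset.sum_le_sum fun γ _ => hpt γ).trans ?_)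
    rw [Finset.sum_add_distrib, ← Finset.mul_sum, ← Finset.mul_sum]
    gcongr
    · exact sum_norm_charSum_mul_le _ _
    · exact sum_norm_charSum_mul_le _ _
  -- This is `hm` in square-root form; it keeps the off-spectrum part below half of the total.
  have hsq : √((#A : ℝ) * #Y) ≤ 2 ^ m * #A / 2 := by
    apply Real.sqrt_le_iff.2 ⟨by positivity, ?_⟩
    have : (2 ^ m * (#A : ℝ) / 2) ^ 2 = #A * (4 ^ m * #A) / 4 := by
      rw [show (4 : ℝ) = 2 ^ 2 by norm_num, ← pow_mul]; ring
    rw [this]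
    nlinarith
  have h2nd : (#A / 2 : ℝ) ^ m * (Fintype.card G * √(#A * #Y)) ≤
      Fintype.card G * (#A : ℝ) ^ (m + 1) / 2 := by
    calc (#A / 2 : ℝ) ^ m * (Fintype.card G * √(#A * #Y))
        ≤ (#A / 2 : ℝ) ^ m * (Fintype.card G * (2 ^ m * #A / 2)) := by gcongr
      _ = _ := by rw [div_pow, pow_succ]; field_simp
  have h5 : (1 : ℝ) / 2 ≤ 2 / #B * √(#B * #Y) := by
    have hpos : (0 : ℝ) < Fintype.card G * (#A : ℝ) ^ (m + 1) := by positivity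
    by_contra! hcon
    have := mul_lt_mul_of_pos_left hcon hpos
    nlinarith
  rw [div_mul_eq_mul_div, le_div_iff₀ hb] at h5
  have h6 : (#B : ℝ) / 4 ≤ √(#B * #Y) := by linarith
  have h7 := (Real.le_sqrt (by positivity) (by positivity)).1 h6
  have : (#B : ℝ) * #B ≤ #B * (16 * #Y) := by nlinarith
  exact le_of_mul_le_mul_left this hb

/-- Each of the two translates of `A` misses at most `t` points of `S`, so `γ x` and `γ y` times
`charSum A γ` are both within `t` of `charSum S γ`. -/
lemma norm_sub_mul_norm_charSum_le [Finite G] [DecidableEq G] (A S : Finset G) {x y : G} {t : ℝ}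
    (hx : x +ᵥ A ⊆ S) (hy : y +ᵥ A ⊆ S) (ht : (#S : ℝ) ≤ #A + t) (γ : AddChar G ℂ) :
    ‖γ x - γ y‖ * ‖charSum A γ‖ ≤ 2 * t := by
  have key : ∀ z : G, z +ᵥ A ⊆ S → ‖charSum S γ - γ z * charSum A γ‖ ≤ t := by
    intro z hz
    have h1 : γ z * charSum A γ = charSum (z +ᵥ A) γ := by
      rw [charSum, charSum, Finset.vadd_finset_def, Finset.sum_image (by simp), Finset.mul_sum]
      simp [AddChar.map_add_eq_mul]
    have h2 : charSum S γ - charSum (z +ᵥ A) γ = charSum (S \ (z +ᵥ A)) γ := by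
      rw [charSum, charSum, charSum, ← Finset.sum_sdiff hz]; ring
    rw [h1, h2]
    refine (norm_charSum_le _ _).trans ?_
    have h3 := Finset.card_sdiff_add_card_eq_card hz
    rw [Finset.card_vadd_finset] at h3
    have h4 : (#(S \ (z +ᵥ A)) : ℝ) + #A = #S := by exact_mod_cast h3
    linarith
  rw [← norm_mul, show (γ x - γ y) * charSum A γ
    = (charSum S γ - γ y * charSum A γ) - (charSum S γ - γ x * charSum A γ) by ring]
  refine (norm_sub_le _ _).trans ?_
  linarith [key x hx, key y hy]

/-- Differences of elements that translate `A` into a slightly larger set are approximately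
annihilated by the large spectrum of `A`. -/
lemma norm_addChar_sub_one_le [Finite G] [DecidableEq G] {A X : Finset G} {η : ℝ}
    (hA : A.Nonempty) (h : (#(A + X) : ℝ) ≤ (1 + η) * #A) {γ : AddChar G ℂ}
    (hγ : (#A : ℝ) ≤ 2 * ‖charSum A γ‖) {x y : G} (hx : x ∈ X) (hy : y ∈ X) :
    ‖γ (x - y) - 1‖ ≤ 4 * η := by
  have ha : (0 : ℝ) < #A := by exact_mod_cast hA.card_pos
  have hsub : ∀ z ∈ X, z +ᵥ A ⊆ A + X := by
    intro z hz w hw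
    obtain ⟨a, haA, rfl⟩ := Finset.mem_vadd_finset.1 hw
    rw [vadd_eq_add, add_comm z]
    exact Finset.add_mem_add haA hz
  have h1 := norm_sub_mul_norm_charSum_le A (A + X) (t := η * #A) (hsub x hx) (hsub y hy)
    (by linarith) γ
  have h2 : ‖γ (x - y) - 1‖ = ‖γ x - γ y‖ := by
    have h3 : γ x - γ y = (γ (x - y) - 1) * γ y := by
      rw [sub_mul, ← AddChar.map_add_eq_mul, sub_add_cancel, one_mul]
    rw [h3, norm_mul, AddChar.norm_apply, mul_one]
  rw [h2]
  have h4 : ‖γ x - γ y‖ * #A ≤ 4 * η * #A := by nlinarith [norm_nonneg (γ x - γ y)]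
  exact le_of_mul_le_mul_right h4 ha

end Fourier

/-! ### Choosing a scale at which the sumset barely grows. -/

section Growth

open Finset

variable {G : Type*} [AddCommGroup G] [DecidableEq G]

lemma card_le_card_succ_nsmul (X : Finset G) (n : ℕ) : #X ≤ #((n + 1) • X) := by
  rcases X.eq_empty_or_nonempty with rfl | hX
  · simp
  · rw [succ_nsmul]
    exact Finset.card_le_card_add_left (hX.nsmul)

/-- Otherwise `N ^ 11` successive growth factors `1 + N⁻⁶` multiply to at least `2 ^ (N ^ 5)`,
beating the allowed `(N ^ 11 + 1) ^ N`. -/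
lemma exists_card_succ_nsmul_le {X : Finset G} (hX : X.Nonempty) {d : ℝ} {N : ℕ} (hN : 3 ≤ N)
    (hd : d ≤ N) (hgrowth : ∀ n : ℕ, 1 ≤ n → (#(n • X) : ℝ) ≤ (n : ℝ) ^ d * #X) :
    ∃ r : ℕ, 1 ≤ r ∧ r ≤ N ^ 11 ∧
      (#((r + 1) • X) : ℝ) ≤ (1 + 1 / (N : ℝ) ^ 6) * #(r • X) := by
  by_contra! hcon
  have hX0 : (0 : ℝ) < #X := by exact_mod_cast hX.card_pos
  have hN0 : (0 : ℝ) < N := by exact_mod_cast (by omega : 0 < N)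
  have hN3 : (3 : ℝ) ≤ N := by exact_mod_cast hN
  have hind : ∀ r : ℕ, r ≤ N ^ 11 →
      (1 + 1 / (N : ℝ) ^ 6) ^ r * #X ≤ (#((r + 1) • X) : ℝ) := by
    intro r
    induction r with
    | zero => intro _; simp
    | succ r ih =>
      intro hr
      have h1 := ih (by omega)
      have h2 := hcon (r + 1) (by omega) hr
      rw [pow_succ]
      calc (1 + 1 / (N : ℝ) ^ 6) ^ r * (1 + 1 / (N : ℝ) ^ 6) * #X
          = (1 + 1 / (N : ℝ) ^ 6) * ((1 + 1 / (N : ℝ) ^ 6) ^ r * #X) := by ring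
        _ ≤ (1 + 1 / (N : ℝ) ^ 6) * #((r + 1) • X) := by gcongr
        _ ≤ _ := h2.le
  have h1 := hind (N ^ 11) le_rfl
  have h2 := hgrowth (N ^ 11 + 1) (by omega)
  have h3 : (1 + 1 / (N : ℝ) ^ 6) ^ (N ^ 11) ≤ ((N ^ 11 + 1 : ℕ) : ℝ) ^ d :=
    le_of_mul_le_mul_right (h1.trans h2) hX0
  have h4 : ((N ^ 11 + 1 : ℕ) : ℝ) ^ d ≤ ((N ^ 11 + 1 : ℕ) : ℝ) ^ N := by
    rw [← Real.rpow_natCast]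
    exact Real.rpow_le_rpow_of_exponent_le (by norm_cast; omega) hd
  have h5 : (2 : ℝ) ^ (N ^ 5) ≤ (1 + 1 / (N : ℝ) ^ 6) ^ (N ^ 11) := by
    have : (2 : ℝ) ≤ (1 + 1 / (N : ℝ) ^ 6) ^ (N ^ 6) := by
      refine le_trans (le_of_eq ?_) (one_add_mul_le_pow (a := 1 / (N : ℝ) ^ 6) ?_ (N ^ 6))
      · push_cast; field_simp; norm_num
      · linarith [show (0 : ℝ) ≤ 1 / (N : ℝ) ^ 6 by positivity]
    calc (2 : ℝ) ^ (N ^ 5) ≤ ((1 + 1 / (N : ℝ) ^ 6) ^ (N ^ 6)) ^ (N ^ 5) := by gcongr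
      _ = _ := by rw [← pow_mul, ← pow_add]
  have h6 : (2 : ℝ) ^ (N ^ 5) ≤ ((N ^ 11 + 1 : ℕ) : ℝ) ^ N := h5.trans (h3.trans h4)
  have h7 : 2 ^ (N ^ 5) ≤ (N ^ 11 + 1) ^ N := by exact_mod_cast h6
  have h8 : N ^ 11 + 1 ≤ N ^ 12 := by
    have : 1 ≤ N ^ 11 := Nat.one_le_pow _ _ (by omega)
    rw [pow_succ N 11]; nlinarith
  have h9 : (N ^ 11 + 1) ^ N < 2 ^ (N ^ 5) := by
    calc (N ^ 11 + 1) ^ N ≤ (N ^ 12) ^ N := by gcongr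
      _ = N ^ (12 * N) := by rw [← pow_mul]
      _ < (2 ^ N) ^ (12 * N) := Nat.pow_lt_pow_left Nat.lt_two_pow_self (by omega)
      _ = 2 ^ (12 * N ^ 2) := by rw [← pow_mul]; ring_nf
      _ ≤ 2 ^ (N ^ 5) := by
        apply Nat.pow_le_pow_right (by norm_num)
        have : 12 ≤ N ^ 3 := le_trans (by norm_num) (Nat.pow_le_pow_left hN 3)
        calc 12 * N ^ 2 ≤ N ^ 3 * N ^ 2 := by gcongr
          _ = N ^ 5 := by ring
  omega

/-- A set of relative polynomial growth has a set of characters, almost trivial on its difference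
set, whose Bohr sets of constant width are small. -/
lemma exists_almost_annihilating_characters [Fintype G] {X : Finset G} (hX : X.Nonempty) {d : ℝ}
    {N : ℕ} (hN : 3 ≤ N) (hd0 : 0 ≤ d) (hd : d ≤ N)
    (hgrowth : ∀ n : ℕ, 1 ≤ n → (#(n • X) : ℝ) ≤ (n : ℝ) ^ d * #X) :
    ∃ Γ : Set (AddChar G ℂ),
      (∀ γ ∈ Γ, ∀ x ∈ X, ∀ y ∈ X, ‖γ (x - y) - 1‖ ≤ 4 * (1 / (N : ℝ) ^ 6)) ∧
      ∀ B : Finset G, (∀ γ ∈ Γ, ∀ g ∈ B, 1 / 2 ≤ (γ g).re) →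
        (#B : ℝ) ≤ 16 * ((N : ℝ) ^ 22) ^ d * #X := by
  obtain ⟨r, hr1, hr2, hr⟩ := exists_card_succ_nsmul_le hX hN hd hgrowth
  have hA : (r • X).Nonempty := hX.nsmul
  have hXA : #X ≤ #(r • X) := by
    obtain ⟨s, rfl⟩ : ∃ s, r = s + 1 := ⟨r - 1, by omega⟩
    exact card_le_card_succ_nsmul X s
  have hN1 : 1 ≤ N ^ 11 := Nat.one_le_pow _ _ (by omega)
  -- Large enough that `4 N ^ (22 N) ≤ 4 ^ m`, small enough that `(m + 1) r ≤ N ^ 22`.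
  obtain ⟨m, hm⟩ : ∃ m, N ^ 11 = m + 1 := ⟨N ^ 11 - 1, by omega⟩
  have hY : (#((m + 1) • (r • X)) : ℝ) ≤ ((N : ℝ) ^ 22) ^ d * #X := by
    rw [smul_smul, ← hm]
    refine (hgrowth (N ^ 11 * r) (Nat.mul_pos (by omega) (by omega))).trans ?_
    gcongr
    have : N ^ 11 * r ≤ N ^ 22 := by
      calc N ^ 11 * r ≤ N ^ 11 * N ^ 11 := by gcongr
        _ = N ^ 22 := by ring
    exact_mod_cast this
  refine ⟨{γ | (#(r • X) : ℝ) ≤ 2 * ‖charSum (r • X) γ‖}, ?_, ?_⟩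
  · intro γ hγ x hx y hy
    exact norm_addChar_sub_one_le hA (by rw [← succ_nsmul]; exact hr) hγ hx hy
  · intro B hB
    refine (card_le_of_re_spectrum (m := m) hA ?_ hB).trans (by linarith)
    have h1 : ((N : ℝ) ^ 22) ^ d ≤ ((N : ℝ) ^ 22) ^ N := by
      rw [← Real.rpow_natCast _ N]
      refine Real.rpow_le_rpow_of_exponent_le ?_ hd
      exact one_le_pow₀ (by exact_mod_cast (by omega : 1 ≤ N))
    have h2 : 4 * (N ^ 22) ^ N ≤ 4 ^ m := by
      calc 4 * (N ^ 22) ^ N = 4 * N ^ (22 * N) := by rw [← pow_mul]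
        _ ≤ 4 * (2 ^ N) ^ (22 * N) := by
          gcongr; exact Nat.lt_two_pow_self.le
        _ = 2 ^ (2 + 22 * N ^ 2) := by rw [← pow_mul, pow_add]; ring_nf
        _ ≤ 2 ^ (2 * m) := by
          apply Nat.pow_le_pow_right (by norm_num)
          have h3 : 3 ^ 9 ≤ N ^ 9 := Nat.pow_le_pow_left hN 9
          have h4 : N ^ 9 * N ^ 2 = m + 1 := by rw [← hm]; ring
          nlinarith [sq_nonneg N, Nat.mul_le_mul_right (N ^ 2) h3, Nat.pow_le_pow_left hN 2]
        _ = 4 ^ m := by rw [pow_mul]; norm_num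
    calc 4 * (#((m + 1) • (r • X)) : ℝ) ≤ 4 * (((N : ℝ) ^ 22) ^ N * #(r • X)) := by
          gcongr
          refine hY.trans ?_
          gcongr
      _ = ((4 * (N ^ 22) ^ N : ℕ) : ℝ) * #(r • X) := by push_cast; ring
      _ ≤ ((4 ^ m : ℕ) : ℝ) * #(r • X) := by gcongr
      _ = _ := by push_cast; ring

end Growth

/-! ### Converting between characters and angles. -/

section Angles

/-- With `w = exp(iθ)`, Jordan's inequality gives `‖w - 1‖ = 2|sin(θ/2)| ≥ 2|θ|/π`; take `z = θ/2π`.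
-/
lemma exists_angle_of_norm_sub_one_le {w : ℂ} (hw : ‖w‖ = 1) {η : ℝ} (h : ‖w - 1‖ ≤ 4 * η) :
    ∃ z : ℝ, |z| ≤ η ∧ w = Complex.exp (2 * Real.pi * z * Complex.I) := by
  have hpi := Real.pi_pos
  set θ := Complex.arg w
  have hwθ : w = Complex.exp (Complex.I * θ) := by
    have := Complex.norm_mul_exp_arg_mul_I w
    rw [hw] at this
    simpa [mul_comm] using this.symm
  have hθ : |θ| ≤ Real.pi := Complex.abs_arg_le_pi w
  refine ⟨θ / (2 * Real.pi), ?_, ?_⟩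
  · rw [hwθ, Complex.norm_exp_I_mul_ofReal_sub_one, norm_mul, Real.norm_eq_abs,
      Real.norm_eq_abs] at h
    have h2 := Real.mul_abs_le_abs_sin (x := θ / 2) (by rw [abs_div, abs_two]; linarith)
    rw [abs_two] at h
    rw [abs_div, abs_of_pos (by positivity : (0 : ℝ) < 2 * Real.pi), div_le_iff₀ (by positivity)]
    rw [abs_div, abs_two] at h2
    have h3 : 2 / Real.pi * (|θ| / 2) ≤ 2 * η := by linarith
    rw [div_mul_eq_mul_div, div_le_iff₀ hpi] at h3
    linarith
  · nth_rewrite 1 [hwθ]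
    congr 1
    push_cast
    field_simp

lemma half_le_re_exp_of_abs_le {z : ℝ} (h : |z| ≤ 1 / 6) :
    1 / 2 ≤ (Complex.exp (2 * Real.pi * z * Complex.I)).re := by
  have h1 : (2 * Real.pi * z * Complex.I : ℂ) = ((2 * Real.pi * z : ℝ) : ℂ) * Complex.I := by
    push_cast; ring
  rw [h1, Complex.exp_ofReal_mul_I_re, ← Real.cos_pi_div_three, ← Real.cos_abs (2 * Real.pi * z)]
  have hpi := Real.pi_pos
  apply Real.cos_le_cos_of_nonneg_of_le_pi (abs_nonneg _) (by linarith)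
  rw [abs_mul, abs_of_pos (by positivity : (0 : ℝ) < 2 * Real.pi)]
  nlinarith

lemma eq_zero_of_exp_eq_one {z : ℝ} (h : |z| < 1)
    (hz : Complex.exp (2 * Real.pi * z * Complex.I) = 1) : z = 0 := by
  rw [Complex.exp_eq_one_iff] at hz
  obtain ⟨n, hn⟩ := hz
  have h1 : (z : ℂ) = n := by
    have hne : (2 * Real.pi * Complex.I : ℂ) ≠ 0 := Complex.two_pi_I_ne_zero
    apply mul_right_cancel₀ hne
    rw [← hn]; ring
  have h2 : z = n := by exact_mod_cast h1
  rw [h2] at h ⊢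
  have h3 : |n| < 1 := by exact_mod_cast h
  rw [Int.abs_lt_one_iff.1 h3]; simp

end Angles

/-! ### Short lattice vectors and growth of Bohr sets. -/

section Lattice

open Finset

/-- A finite set contains a basis of its span in which all its elements have coordinates at most
`1` in absolute value. -/
lemma exists_bounded_coordinates {E : Type*} [AddCommGroup E] [Module ℝ E]
    [FiniteDimensional ℝ E] {S : Set E} (hS : S.Finite) :
    ∃ (k : ℕ) (v : Fin k → E), LinearIndependent ℝ v ∧ (∀ i, v i ∈ S) ∧
      ∀ s ∈ S, ∃ t : Fin k → ℝ, (∀ i, |t i| ≤ 1) ∧ s = ∑ i, t i • v i := by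
  classical
  let V := Submodule.span ℝ S
  obtain ⟨k, hk⟩ : ∃ k, k = Module.finrank ℝ V := ⟨_, rfl⟩
  obtain ⟨f, hfS, -, hfli⟩ : ∃ f : Fin k → E, (∀ i, f i ∈ S) ∧
      Submodule.span ℝ (Set.range f) = V ∧ LinearIndependent ℝ f := by
    rw [hk]
    exact Submodule.exists_fun_fin_finrank_span_eq ℝ S
  have hfin : Finite S := hS
  have hmem : ∀ s : S, (s : E) ∈ V := fun s => Submodule.subset_span s.2
  let ι : S → V := fun s => ⟨s, hmem s⟩
  let e : Module.Basis (Fin k) ℝ V := Module.finBasisOfFinrankEq ℝ V hk.symm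
  let f' : Fin k → S := fun i => ⟨f i, hfS i⟩
  have : Nonempty (Fin k → S) := ⟨f'⟩
  -- Maximise the determinant over `k`-tuples from `S`. By Cramer's rule, a coordinate of `s` is the
  -- ratio by which the determinant changes when a basis vector is replaced by `s`, hence at most
  -- `1` in absolute value.
  obtain ⟨w, hw⟩ := Finite.exists_max (fun w : Fin k → S => |e.det (fun i => ι (w i))|)
  have hf'li : LinearIndependent ℝ (fun i => ι (f' i)) := by
    apply LinearIndependent.of_comp V.subtype
    exact hfli
  have hunit : ∀ u : Fin k → V, e.det u ≠ 0 ↔ LinearIndependent ℝ u := by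
    intro u
    constructor
    · intro h
      exact ((Module.Basis.is_basis_iff_det e).2 (isUnit_iff_ne_zero.2 h)).1
    · intro h
      have h2 : Submodule.span ℝ (Set.range u) = ⊤ :=
        h.span_eq_top_of_card_eq_finrank' (by simp [hk])
      exact ((Module.Basis.is_basis_iff_det e).1 ⟨h, h2⟩).ne_zero
  have hdet : e.det (fun i => ι (w i)) ≠ 0 := by
    have h1 : 0 < |e.det (fun i => ι (f' i))| := abs_pos.2 ((hunit _).2 hf'li)
    exact abs_pos.1 (h1.trans_le (hw f'))
  have hli := (hunit _).1 hdet
  have hsp : ⊤ ≤ Submodule.span ℝ (Set.range fun i => ι (w i)) :=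
    (hli.span_eq_top_of_card_eq_finrank' (by simp [hk])).ge
  refine ⟨k, fun i => (w i : E), hli.map' V.subtype V.ker_subtype, fun i => (w i).2, ?_⟩
  intro s hs
  let b := Module.Basis.mk hli hsp
  refine ⟨fun i => b.repr (ι ⟨s, hs⟩) i, ?_, ?_⟩
  · intro i
    have h1 := LinearMap.congr_fun (e.det_smul_mk_coord_eq_det_update hli hsp i) (ι ⟨s, hs⟩)
    have h2 : e.det.toMultilinearMap.toLinearMap (fun i => ι (w i)) i (ι ⟨s, hs⟩)
        = e.det (fun j => ι (Function.update w i ⟨s, hs⟩ j)) := by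
      rw [MultilinearMap.toLinearMap_apply]
      refine congrArg e.det (funext fun j => ?_)
      by_cases hj : j = i
      · subst hj; simp
      · simp [hj]
    rw [h2, LinearMap.smul_apply, smul_eq_mul] at h1
    have h3 := hw (Function.update w i ⟨s, hs⟩)
    rw [← h1, abs_mul] at h3
    have h4 : 0 < |e.det (fun i => ι (w i))| := abs_pos.2 hdet
    exact le_of_mul_le_mul_left (by rw [mul_one]; exact h3) h4
  · have h1 := b.sum_repr (ι ⟨s, hs⟩)
    have h2 := congrArg (Subtype.val) h1
    simp only [Submodule.coe_sum, Submodule.coe_smul] at h2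
    refine h2.symm.trans (Finset.sum_congr rfl fun i _ => ?_)
    rw [show b i = ι (w i) from Module.Basis.mk_apply hli hsp i]

lemma discreteTopology_of_forall_norm_lt {E : Type*} [NormedAddCommGroup E] {L : Submodule ℤ E} {δ : ℝ} (hδ : 0 < δ)
    (h : ∀ z ∈ L, ‖z‖ < δ → z = 0) : DiscreteTopology L := by
  rw [discreteTopology_iff_isOpen_singleton_zero, Metric.isOpen_singleton_iff]
  refine ⟨δ, hδ, fun y hy => ?_⟩
  rw [dist_zero_right] at hy
  exact Subtype.ext (h y y.2 hy)

variable {E : Type*} [NormedAddCommGroup E] [NormedSpace ℝ E]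

/-- The classes modulo `m` of a lattice have many small representatives. -/
lemma exists_small_representatives [FiniteDimensional ℝ E] {k m : ℕ} (hm : 0 < m)
    {L : Submodule ℤ E} [DiscreteTopology L] {v : Fin k → E} {ε : ℝ}
    (hv : LinearIndependent ℝ v) (hvL : ∀ i, v i ∈ L) (hvε : ∀ i, ‖v i‖ ≤ ε)
    (hspan : ∀ z ∈ L, z ∈ Submodule.span ℝ (Set.range v)) :
    ∃ y : (Fin k → Fin m) → E, (∀ c, y c ∈ L ∧ ‖y c‖ ≤ m * k * ε) ∧
      ∀ c c', ∀ w ∈ L, y c - y c' = (m : ℤ) • w → c = c' := by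
  classical
  have hm0 : (0 : ℝ) < m := by exact_mod_cast hm
  -- Rounding each `t i / m` down reduces `z` modulo `m` to a combination of the `v i` with
  -- coefficients in `[0, m)`.
  have hrep : ∀ z ∈ L, ∃ w ∈ L, ‖z - (m : ℤ) • w‖ ≤ m * k * ε := by
    intro z hz
    obtain ⟨t, rfl⟩ := (Submodule.mem_span_range_iff_exists_fun ℝ).1 (hspan z hz)
    refine ⟨∑ i, ⌊t i / m⌋ • v i, Submodule.sum_mem _ fun i _ => L.smul_mem _ (hvL i), ?_⟩
    have h1 : ∑ i, t i • v i - (m : ℤ) • ∑ i, ⌊t i / m⌋ • v i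
        = ∑ i, (m * Int.fract (t i / m)) • v i := by
      rw [Finset.smul_sum, ← Finset.sum_sub_distrib]
      refine Finset.sum_congr rfl fun i _ => ?_
      rw [← Int.cast_smul_eq_zsmul ℝ, ← Int.cast_smul_eq_zsmul ℝ, smul_smul, ← sub_smul]
      congr 1
      rw [Int.fract, mul_sub, mul_div_cancel₀ _ hm0.ne']
      simp
    rw [h1]
    refine (norm_sum_le _ _).trans ?_
    calc ∑ i, ‖(m * Int.fract (t i / m)) • v i‖ ≤ ∑ i : Fin k, m * ε := by
          refine Finset.sum_le_sum fun i _ => ?_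
          rw [norm_smul, Real.norm_eq_abs, abs_of_nonneg (by positivity)]
          have := (Int.fract_lt_one (t i / m)).le
          calc m * Int.fract (t i / m) * ‖v i‖ ≤ m * 1 * ε := by
                gcongr; exact hvε i
            _ = m * ε := by ring
      _ = _ := by simp; ring
  have hcard : k ≤ Module.finrank ℤ L := by
    have hli : LinearIndependent ℤ (fun i => (⟨v i, hvL i⟩ : L)) := by
      apply LinearIndependent.of_comp L.subtype
      exact hv.restrict_scalars' ℤ
    simpa using hli.fintype_card_le_finrank
  let b := Module.Free.chooseBasis ℤ L
  obtain ⟨e⟩ : Nonempty (Fin k ↪ Module.Free.ChooseBasisIndex ℤ L) := by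
    apply Function.Embedding.nonempty_of_card_le
    rwa [Fintype.card_fin, ← Module.finrank_eq_card_chooseBasisIndex]
  -- Digit vectors on `k` elements of a `ℤ`-basis of `L` are pairwise incongruent modulo `m`.
  let u : (Fin k → Fin m) → L := fun c => ∑ i, ((c i : ℕ) : ℤ) • b (e i)
  choose! w hwL hw using hrep
  refine ⟨fun c => u c - (m : ℤ) • w (u c), fun c => ⟨?_, hw _ (u c).2⟩, ?_⟩
  · exact L.sub_mem (u c).2 (L.smul_mem _ (hwL _ (u c).2))
  · intro c c' x hx hcc
    have h1 : u c - u c' = (m : ℤ) •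
        ((⟨x, hx⟩ : L) + ⟨w (u c), hwL _ (u c).2⟩ - ⟨w (u c'), hwL _ (u c').2⟩) := by
      apply Subtype.ext
      push_cast
      rw [smul_sub, smul_add, ← hcc]
      beta_reduce
      abel
    funext i
    have h2 := congrArg (fun z => b.repr z (e i)) h1
    have h3 : ∀ c : Fin k → Fin m, b.repr (u c) (e i) = ((c i : ℕ) : ℤ) := by
      intro c
      simp only [u, map_sum, map_smul, Module.Basis.repr_self, Finsupp.coe_finsetSum,
        Finset.sum_apply, Finsupp.smul_apply, smul_eq_mul, Finsupp.single_apply,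
        e.injective.eq_iff]
      simp
    simp only [map_sub, map_smul, Finsupp.sub_apply, Finsupp.smul_apply, h3, smul_eq_mul] at h2
    have h4 : ((m : ℕ) : ℤ) ∣ ((c i : ℕ) : ℤ) - ((c' i : ℕ) : ℤ) := ⟨_, h2⟩
    apply Fin.ext
    have h5 := (c i).2
    have h6 := (c' i).2
    have h7 := Int.emod_emod_of_dvd ((c i : ℕ) : ℤ) (dvd_refl (m : ℤ))
    have h8 := (Int.emod_emod_of_dvd ((c' i : ℕ) : ℤ) (dvd_refl (m : ℤ)))
    have h9 := Int.emod_eq_emod_iff_emod_sub_eq_zero.2 (Int.emod_eq_zero_of_dvd h4)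
    rw [Int.emod_eq_of_lt (by omega) (by omega), Int.emod_eq_of_lt (by omega) (by omega)] at h9
    exact_mod_cast h9

/-- Many independent small vectors in the frequency lattice force the associated Bohr sets to
grow. -/
lemma pow_mul_card_le_card [FiniteDimensional ℝ E] {G : Type*} [AddCommGroup G] [Finite G]
    {Λ : AddSubgroup (E × G)} {ρ ε : ℝ} (hρ : 0 < ρ)
    (hinj : ∀ z : E, (z, (0 : G)) ∈ Λ → ‖z‖ ≤ 2 * ρ → z = 0)
    {k m : ℕ} (hm : 0 < m) {v : Fin k → E} (hv : LinearIndependent ℝ v)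
    (hvΛ : ∀ i, ∃ g, (v i, g) ∈ Λ) (hvε : ∀ i, ‖v i‖ ≤ ε) (hmk : m * (k + 1) * ε ≤ ρ)
    {B B' : Finset G} (hB : ∀ g ∈ B, ∃ z, ‖z‖ ≤ ε ∧ (z, g) ∈ Λ)
    (hB' : ∀ z g, ‖z‖ ≤ ρ → (z, g) ∈ Λ → g ∈ B') :
    m ^ k * #B ≤ #B' := by
  classical
  let L : Submodule ℤ E := AddSubgroup.toIntSubmodule (Λ.map (AddMonoidHom.fst E G))
  have hL : ∀ z, z ∈ L ↔ ∃ g, (z, g) ∈ Λ := by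
    intro z
    constructor
    · rintro ⟨⟨z', g⟩, h, rfl⟩
      exact ⟨g, h⟩
    · rintro ⟨g, h⟩
      exact ⟨(z, g), h, rfl⟩
  let L' : Submodule ℤ E := L ⊓ (Submodule.span ℝ (Set.range v)).restrictScalars ℤ
  have hcard : (0 : ℝ) < Nat.card G := by exact_mod_cast Nat.card_pos
  -- Multiplying by `Nat.card G` kills the `G`-component, so `hinj` excludes nonzero vectors shorter
  -- than `ρ / Nat.card G`.
  have hdisc : DiscreteTopology L' := by
    refine discreteTopology_of_forall_norm_lt (δ := ρ / Nat.card G) (by positivity) ?_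
    intro z hz hzδ
    obtain ⟨g, hg⟩ := (hL z).1 hz.1
    have h1 := Λ.nsmul_mem hg (Nat.card G)
    rw [Prod.smul_mk, card_nsmul_eq_zero'] at h1
    have h2 := hinj _ h1 (by
      rw [← Nat.cast_smul_eq_nsmul ℝ, norm_smul, Real.norm_natCast]
      rw [lt_div_iff₀ hcard] at hzδ
      linarith)
    rw [← Nat.cast_smul_eq_nsmul ℝ, smul_eq_zero] at h2
    exact h2.resolve_left hcard.ne'
  obtain ⟨y, hy, hyinj⟩ := exists_small_representatives hm (L := L') hv
    (fun i => ⟨(hL _).2 (hvΛ i), Submodule.subset_span ⟨i, rfl⟩⟩) hvε (fun z hz => hz.2)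
  have hex : ∀ z, ∃ g, z ∈ L → (z, g) ∈ Λ := by
    intro z
    by_cases h : z ∈ L
    · obtain ⟨g, hg⟩ := (hL z).1 h
      exact ⟨g, fun _ => hg⟩
    · exact ⟨0, fun h' => absurd h' h⟩
  choose γ hγ using hex
  choose! s hsε hsΛ using hB
  have hsL : ∀ g ∈ B, s g ∈ L := fun g hg => (hL _).2 ⟨g, hsΛ g hg⟩
  let F : (Fin k → Fin m) × G → E := fun p => y p.1 + (m : ℤ) • s p.2
  have hFL : ∀ p : (Fin k → Fin m) × G, p.2 ∈ B → F p ∈ L := fun p hp =>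
    L.add_mem (hy p.1).1.1 (L.smul_mem _ (hsL _ hp))
  have hFρ : ∀ p : (Fin k → Fin m) × G, p.2 ∈ B → ‖F p‖ ≤ ρ := by
    intro p hp
    refine (norm_add_le _ _).trans ?_
    rw [← Int.cast_smul_eq_zsmul ℝ, norm_smul]
    simp only [Int.cast_natCast, Real.norm_natCast]
    have h1 := (hy p.1).2
    have h2 : (m : ℝ) * ‖s p.2‖ ≤ m * ε := by gcongr; exact hsε _ hp
    nlinarith
  -- A fixed lift `γ` of the angle vector `F p`, corrected by an element over `0` so that `p.2`
  -- remains recoverable among elements sharing the same `s`.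
  let Φ : (Fin k → Fin m) × G → G := fun p => γ (F p) + (p.2 - γ (s p.2))
  have hker : ∀ g ∈ B, ((0 : E), g - γ (s g)) ∈ Λ := by
    intro g hg
    have := Λ.sub_mem (hsΛ g hg) (hγ _ (hsL g hg))
    simpa using this
  have hΦΛ : ∀ p : (Fin k → Fin m) × G, p.2 ∈ B → (F p, Φ p) ∈ Λ := by
    intro p hp
    have := Λ.add_mem (hγ _ (hFL p hp)) (hker _ hp)
    simpa using this
  have hmain : #((univ : Finset (Fin k → Fin m)) ×ˢ B) ≤ #B' := by
    refine Finset.card_le_card_of_injOn Φ ?_ ?_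
    · intro p hp
      have hp2 : p.2 ∈ B := (Finset.mem_product.1 hp).2
      exact hB' _ _ (hFρ p hp2) (hΦΛ p hp2)
    · intro p hp q hq hpq
      have hp2 : p.2 ∈ B := (Finset.mem_product.1 hp).2
      have hq2 : q.2 ∈ B := (Finset.mem_product.1 hq).2
      have h1 : F p = F q := by
        have h2 := Λ.sub_mem (hΦΛ p hp2) (hΦΛ q hq2)
        rw [Prod.mk_sub_mk, hpq, sub_self] at h2
        refine sub_eq_zero.1 (hinj _ h2 ?_)
        refine (norm_sub_le _ _).trans ?_
        linarith [hFρ p hp2, hFρ q hq2]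
      have h3 : y p.1 - y q.1 = (m : ℤ) • (s q.2 - s p.2) := by
        have : y p.1 + (m : ℤ) • s p.2 = y q.1 + (m : ℤ) • s q.2 := h1
        rw [smul_sub, sub_eq_sub_iff_add_eq_add, this, add_comm]
      have hm0 : (m : ℝ) ≠ 0 := by exact_mod_cast hm.ne'
      -- The `s g` themselves may leave the span of `v`; this difference does not, being `1/m` times
      -- a difference of representatives.
      have h4 : s q.2 - s p.2 ∈ L' := by
        refine ⟨L.sub_mem (hsL _ hq2) (hsL _ hp2), ?_⟩
        have h5 : s q.2 - s p.2 = (m : ℝ)⁻¹ • (y p.1 - y q.1) := by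
          rw [h3, ← Int.cast_smul_eq_zsmul ℝ, Int.cast_natCast, inv_smul_smul₀ hm0]
        rw [h5]
        exact (Submodule.span ℝ (Set.range v)).smul_mem _ (Submodule.sub_mem _ (hy p.1).1.2 (hy q.1).1.2)
      have h6 : p.1 = q.1 := hyinj _ _ _ h4 h3
      have h7 : s p.2 = s q.2 := by
        rw [h6, sub_self, ← Int.cast_smul_eq_zsmul ℝ, Int.cast_natCast] at h3
        exact (sub_eq_zero.1 ((smul_eq_zero.1 h3.symm).resolve_left hm0)).symm
      have h8 : p.2 = q.2 := by
        have h9 : γ (F p) + (p.2 - γ (s p.2)) = γ (F q) + (q.2 - γ (s q.2)) := hpq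
        rw [h1, h7] at h9
        simpa using h9
      exact Prod.ext h6 h8
  simpa [Finset.card_product] using hmain

end Lattice

/-! ### The frequency subgroup of a finite group. -/

section FiniteGroups

open Finset

/-- The pairs `(z, g)` such that `z γ` is an angle of `γ g` for all `γ ∈ Γ`. -/
noncomputable def angleSubgroup {G : Type*} [AddCommGroup G] (Γ : Set (AddChar G ℂ)) :
    AddSubgroup ((Γ → ℝ) × G) where
  carrier := {p | ∀ γ : Γ, (γ : AddChar G ℂ) p.2 = Complex.exp (2 * Real.pi * p.1 γ * Complex.I)}
  zero_mem' := by intro γ; simp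
  add_mem' := by
    intro p q hp hq γ
    have h : (2 * Real.pi * ((p + q).1 γ : ℝ) * Complex.I : ℂ)
        = 2 * Real.pi * p.1 γ * Complex.I + 2 * Real.pi * q.1 γ * Complex.I := by
      simp only [Prod.fst_add, Pi.add_apply]
      push_cast; ring
    rw [h, Complex.exp_add, ← hp γ, ← hq γ, Prod.snd_add, AddChar.map_add_eq_mul]
  neg_mem' := by
    intro p hp γ
    have h : (2 * Real.pi * ((-p).1 γ : ℝ) * Complex.I : ℂ)
        = -(2 * Real.pi * p.1 γ * Complex.I) := by
      simp only [Prod.fst_neg, Pi.neg_apply]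
      push_cast; ring
    rw [h, Complex.exp_neg, ← hp γ, Prod.snd_neg, AddChar.map_neg_eq_inv]

lemma mem_angleSubgroup {G : Type*} [AddCommGroup G] {Γ : Set (AddChar G ℂ)} {z : Γ → ℝ}
    {g : G} : (z, g) ∈ angleSubgroup Γ ↔
      ∀ γ : Γ, (γ : AddChar G ℂ) g = Complex.exp (2 * Real.pi * z γ * Complex.I) := Iff.rfl

/-- The structure of sets of relative polynomial growth in finite groups. -/
lemma exists_addSubgroup_of_finite {G : Type*} [AddCommGroup G] [Finite G] [DecidableEq G]
    {X : Finset G} (hX : X.Nonempty) {d : ℝ} {N : ℕ} (hN : 4 ≤ N) (hd0 : 0 ≤ d) (hd : d ≤ N)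
    (hgrowth : ∀ n : ℕ, 1 ≤ n → (#(n • X) : ℝ) ≤ (n : ℝ) ^ d * #X) :
    ∃ k < 23 * N, ∃ Λ : AddSubgroup ((Fin k → ℝ) × G),
      (∀ x ∈ X, ∀ y ∈ X, ∃ t, ‖t‖ ≤ 1 ∧ (t, x - y) ∈ Λ) ∧
      (∀ t, (t, (0 : G)) ∈ Λ → ‖t‖ ≤ 4 → t = 0) ∧
      ∀ T : Finset G, (∀ g ∈ T, ∃ t, ‖t‖ ≤ 2 ∧ (t, g) ∈ Λ) →
        (#T : ℝ) ≤ 16 * ((N : ℝ) ^ 22) ^ d * #X := by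
  classical
  have := Fintype.ofFinite G
  obtain ⟨Γ, hΓ, hbohr⟩ := exists_almost_annihilating_characters hX (by omega) hd0 hd hgrowth
  have hfinΓ : Fintype Γ := Fintype.ofFinite Γ
  have hN4 : (4 : ℝ) ≤ N := by exact_mod_cast hN
  have hN0 : (0 : ℝ) < N := by linarith
  have hX0 : (0 : ℝ) < #X := by exact_mod_cast hX.card_pos
  have hpow : ∀ n : ℕ, (4 : ℝ) ^ n ≤ (N : ℝ) ^ n := fun n => pow_le_pow_left₀ (by norm_num) hN4 n
  set ε : ℝ := 1 / (N : ℝ) ^ 6 with hε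
  have hε0 : 0 < ε := by positivity
  have hεN : ε * N ^ 6 = 1 := by rw [hε]; field_simp
  set Λ₀ := angleSubgroup Γ
  have hinj : ∀ z : Γ → ℝ, (z, (0 : G)) ∈ Λ₀ → ‖z‖ ≤ 2 * (1 / 6) → z = 0 := by
    intro z hz hz'
    funext γ
    apply eq_zero_of_exp_eq_one
    · have := norm_le_pi_norm z γ
      rw [Real.norm_eq_abs] at this
      linarith
    · rw [← mem_angleSubgroup.1 hz γ]; simp
  have hsmall : ∀ T : Finset G, (∀ g ∈ T, ∃ z : Γ → ℝ, ‖z‖ ≤ 1 / 6 ∧ (z, g) ∈ Λ₀) →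
      (#T : ℝ) ≤ 16 * ((N : ℝ) ^ 22) ^ d * #X := by
    intro T hT
    refine hbohr T fun γ hγ g hg => ?_
    obtain ⟨z, hz, hzg⟩ := hT g hg
    rw [mem_angleSubgroup.1 hzg ⟨γ, hγ⟩]
    exact half_le_re_exp_of_abs_le ((norm_le_pi_norm z _).trans hz)
  have hdiff : ∀ x ∈ X, ∀ y ∈ X, ∃ z : Γ → ℝ, ‖z‖ ≤ ε ∧ (z, x - y) ∈ Λ₀ := by
    intro x hx y hy
    have h1 : ∀ γ : Γ, ∃ z : ℝ, |z| ≤ ε ∧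
        (γ : AddChar G ℂ) (x - y) = Complex.exp (2 * Real.pi * z * Complex.I) := fun γ =>
      exists_angle_of_norm_sub_one_le (AddChar.norm_apply _ _) (hΓ γ γ.2 x hx y hy)
    choose z hz hzγ using h1
    exact ⟨z, (pi_norm_le_iff_of_nonneg hε0.le).2 hz, hzγ⟩
  have hε6 : ε ≤ 1 / 6 := by
    have := hpow 6
    nlinarith
  let S : Set (Γ → ℝ) := {z | ‖z‖ ≤ ε ∧ ∃ g, (z, g) ∈ Λ₀}
  have hS : S.Finite := by
    have h1 : ∀ z : S, ∃ g, ((z : Γ → ℝ), g) ∈ Λ₀ := fun z => z.2.2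
    choose f hf using h1
    have hfinj : Function.Injective f := by
      intro z w hzw
      have h2 := Λ₀.sub_mem (hf z) (hf w)
      rw [hzw, Prod.mk_sub_mk, sub_self] at h2
      have h3 := hinj _ h2 ((norm_sub_le _ _).trans (by linarith [z.2.1, w.2.1]))
      exact Subtype.ext (sub_eq_zero.1 h3)
    have := Finite.of_injective f hfinj
    exact Set.toFinite S
  obtain ⟨k, v, hv, hvS, hcoord⟩ := exists_bounded_coordinates hS
  -- Otherwise `N ^ (23 N) |X| ≤ 16 N ^ (22 N) |X|`, impossible since `N ^ N ≥ 4 ^ 4`.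
  have hk : k < 23 * N := by
    by_contra! hk
    let B : Finset G := univ.filter fun g => ∃ z : Γ → ℝ, ‖z‖ ≤ ε ∧ (z, g) ∈ Λ₀
    let B' : Finset G := univ.filter fun g => ∃ z : Γ → ℝ, ‖z‖ ≤ 1 / 6 ∧ (z, g) ∈ Λ₀
    have h1 : N ^ (23 * N) * #B ≤ #B' := by
      refine pow_mul_card_le_card (Λ := Λ₀) (ρ := 1 / 6) (ε := ε) (by norm_num) hinj (by omega)
        (v := v ∘ Fin.castLE hk) (hv.comp _ (Fin.castLE_injective hk)) (fun i => (hvS _).2)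
        (fun i => (hvS _).1) ?_ (fun g hg => (Finset.mem_filter.1 hg).2)
        (fun z g hz hzg => Finset.mem_filter.2 ⟨Finset.mem_univ _, z, hz, hzg⟩)
      have h2 := hpow 4
      have h3 : ((N : ℝ) * (23 * N + 1)) ≤ 1 / 6 * N ^ 6 := by
        have : (N : ℝ) ^ 2 * 4 ^ 4 ≤ N ^ 2 * N ^ 4 := by gcongr
        nlinarith
      calc (N : ℝ) * (((23 * N : ℕ) : ℝ) + 1) * ε = N * (23 * N + 1) * ε := by push_cast; ring
        _ ≤ 1 / 6 * N ^ 6 * ε := by gcongr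
        _ = 1 / 6 := by linear_combination (1 / 6 : ℝ) * hεN
    have h2 : #X ≤ #B := by
      obtain ⟨x₀, hx₀⟩ := hX
      refine Finset.card_le_card_of_injOn (fun x => x - x₀) ?_ ?_
      · intro x hx
        exact Finset.mem_filter.2 ⟨Finset.mem_univ _, hdiff x hx x₀ hx₀⟩
      · intro x _ y _ hxy
        simpa using hxy
    have h3 := hsmall B' fun g hg => (Finset.mem_filter.1 hg).2
    have h4 : ((N : ℝ) ^ 22) ^ d ≤ ((N : ℝ) ^ 22) ^ N := by
      rw [← Real.rpow_natCast _ N]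
      exact Real.rpow_le_rpow_of_exponent_le (one_le_pow₀ (by linarith)) hd
    have h5 : (N : ℝ) ^ (23 * N) * #X ≤ 16 * ((N : ℝ) ^ 22) ^ N * #X := by
      calc (N : ℝ) ^ (23 * N) * #X ≤ (N : ℝ) ^ (23 * N) * #B := by gcongr
        _ ≤ #B' := by exact_mod_cast h1
        _ ≤ _ := h3
        _ ≤ _ := by gcongr
    have h6 := le_of_mul_le_mul_right h5 hX0
    have h7 : (N : ℝ) ^ (23 * N) = N ^ N * (N ^ 22) ^ N := by
      rw [← pow_mul, ← pow_add]; ring_nf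
    rw [h7] at h6
    have h8 := le_of_mul_le_mul_right h6 (by positivity)
    have h9 : (4 : ℝ) ^ 4 ≤ N ^ N :=
      (hpow 4).trans (pow_le_pow_right₀ (by linarith) hN)
    norm_num at h9
    linarith
  have hkε : 4 * k * ε ≤ 1 / 3 := by
    have h1 : (k : ℝ) ≤ 23 * N := by exact_mod_cast hk.le
    have h2 : 4 * (23 * (N : ℝ)) ≤ 1 / 3 * N ^ 6 := by
      have : (N : ℝ) * 4 ^ 5 ≤ N * N ^ 5 := by gcongr
      nlinarith
    calc 4 * k * ε ≤ 4 * (23 * N) * ε := by gcongr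
      _ ≤ 1 / 3 * N ^ 6 * ε := by gcongr
      _ = 1 / 3 := by linear_combination (1 / 3 : ℝ) * hεN
  -- Pulling back along `σ` makes the `v i` the standard basis. Since `4kε ≤ 1/3`, cubes of radius
  -- `4` and `2` land in the balls of radius `1/3` (injectivity) and `1/6` (Bohr set); the slack is
  -- spent in the limit.
  let σ : (Fin k → ℝ) →+ (Γ → ℝ) := (Fintype.linearCombination ℝ v).toAddMonoidHom
  have hσ : ∀ t, σ t = ∑ i, t i • v i := fun t => Fintype.linearCombination_apply ℝ v t
  have hσnorm : ∀ t, ‖σ t‖ ≤ ‖t‖ * (k * ε) := by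
    intro t
    rw [hσ]
    refine (norm_sum_le _ _).trans ?_
    calc ∑ i, ‖t i • v i‖ ≤ ∑ i : Fin k, ‖t‖ * ε := by
          refine Finset.sum_le_sum fun i _ => ?_
          rw [norm_smul]
          gcongr
          · exact norm_le_pi_norm t i
          · exact (hvS i).1
      _ = _ := by simp; ring
  refine ⟨k, hk, Λ₀.comap (σ.prodMap (AddMonoidHom.id G)), ?_, ?_, ?_⟩
  · intro x hx y hy
    obtain ⟨z, hz, hzΛ⟩ := hdiff x hx y hy
    obtain ⟨t, ht, rfl⟩ := hcoord z ⟨hz, _, hzΛ⟩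
    refine ⟨t, (pi_norm_le_iff_of_nonneg zero_le_one).2 ht, ?_⟩
    change (σ t, x - y) ∈ Λ₀
    rw [hσ]; exact hzΛ
  · intro t ht ht4
    have h1 : σ t = 0 := by
      refine hinj _ ht ((hσnorm t).trans ?_)
      calc ‖t‖ * (k * ε) ≤ 4 * (k * ε) := by gcongr
        _ ≤ _ := by linarith
    rw [hσ] at h1
    funext i
    exact Fintype.linearIndependent_iff.1 hv t h1 i
  · intro T hT
    refine hsmall T fun g hg => ?_
    obtain ⟨t, ht, htg⟩ := hT g hg
    refine ⟨σ t, (hσnorm t).trans ?_, htg⟩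
    calc ‖t‖ * (k * ε) ≤ 2 * (k * ε) := by gcongr
      _ ≤ _ := by linarith

end FiniteGroups

/-! ### Limits of subgroups of `ℝ ^ k × G`. -/

section UltrafilterLimit

open Finset Filter

variable {G I : Type*} [AddCommGroup G] {k : ℕ}

/-- The limit along a filter of a family of subgroups of `ℝ ^ k × G`. -/
def limitSubgroup (U : Filter I) (Λ : I → AddSubgroup ((Fin k → ℝ) × G)) :
    AddSubgroup ((Fin k → ℝ) × G) where
  carrier := {p | ∀ δ > 0, ∀ᶠ j in U, ∃ t, ‖t - p.1‖ < δ ∧ (t, p.2) ∈ Λ j}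
  zero_mem' := by
    intro δ hδ
    exact Eventually.of_forall fun j => ⟨0, by simpa using hδ, (Λ j).zero_mem⟩
  add_mem' := by
    intro p q hp hq δ hδ
    filter_upwards [hp (δ / 2) (by positivity), hq (δ / 2) (by positivity)] with j h1 h2
    obtain ⟨t, ht, htΛ⟩ := h1
    obtain ⟨s, hs, hsΛ⟩ := h2
    refine ⟨t + s, ?_, (Λ j).add_mem htΛ hsΛ⟩
    rw [Prod.fst_add, add_sub_add_comm]
    exact (norm_add_le _ _).trans_lt (by linarith)
  neg_mem' := by
    intro p hp δ hδ
    filter_upwards [hp δ hδ] with j h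
    obtain ⟨t, ht, htΛ⟩ := h
    refine ⟨-t, ?_, (Λ j).neg_mem htΛ⟩
    rw [Prod.fst_neg, neg_sub_neg, norm_sub_rev]
    exact ht

lemma mem_limitSubgroup {U : Filter I} {Λ : I → AddSubgroup ((Fin k → ℝ) × G)}
    {t : Fin k → ℝ} {g : G} : (t, g) ∈ limitSubgroup U Λ ↔
      ∀ δ > 0, ∀ᶠ j in U, ∃ s, ‖s - t‖ < δ ∧ (s, g) ∈ Λ j := Iff.rfl

/-- Compactness of the unit ball makes the chosen vectors converge along the ultrafilter. -/
lemma exists_mem_limitSubgroup (U : Ultrafilter I) {Λ : I → AddSubgroup ((Fin k → ℝ) × G)}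
    {g : G} (h : ∀ᶠ j in (U : Filter I), ∃ t, ‖t‖ ≤ 1 ∧ (t, g) ∈ Λ j) :
    ∃ t, ‖t‖ ≤ 1 ∧ (t, g) ∈ limitSubgroup U Λ := by
  have h' : ∀ j, ∃ t : Fin k → ℝ, (∃ t, ‖t‖ ≤ 1 ∧ (t, g) ∈ Λ j) → ‖t‖ ≤ 1 ∧ (t, g) ∈ Λ j := by
    intro j
    by_cases hj : ∃ t, ‖t‖ ≤ 1 ∧ (t, g) ∈ Λ j
    · exact ⟨hj.choose, fun _ => hj.choose_spec⟩
    · exact ⟨0, fun hj' => absurd hj' hj⟩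
  choose f hf using h'
  have hmem : ∀ᶠ j in (U : Filter I), f j ∈ Metric.closedBall (0 : Fin k → ℝ) 1 := by
    filter_upwards [h] with j hj
    simpa using (hf j hj).1
  obtain ⟨t, ht, htU⟩ := (isCompact_closedBall (0 : Fin k → ℝ) 1).ultrafilter_le_nhds
    (U.map f) (le_principal_iff.2 hmem)
  refine ⟨t, by simpa using ht, mem_limitSubgroup.2 fun δ hδ => ?_⟩
  have h1 : ∀ᶠ j in (U : Filter I), f j ∈ Metric.ball t δ := htU (Metric.ball_mem_nhds t hδ)
  filter_upwards [h, h1] with j hj hj1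
  exact ⟨f j, by rwa [Metric.mem_ball, dist_eq_norm] at hj1, (hf j hj).2⟩

lemma eq_zero_of_mem_limitSubgroup {U : Filter I} [U.NeBot]
    {Λ : I → AddSubgroup ((Fin k → ℝ) × G)}
    (h : ∀ᶠ j in U, ∀ t, (t, (0 : G)) ∈ Λ j → ‖t‖ ≤ 4 → t = 0) {t : Fin k → ℝ}
    (ht : (t, (0 : G)) ∈ limitSubgroup U Λ) (ht2 : ‖t‖ ≤ 2) : t = 0 := by
  by_contra hne
  have hpos : 0 < ‖t‖ := norm_pos_iff.2 hne
  obtain ⟨j, ⟨s, hs, hsΛ⟩, hj⟩ := ((mem_limitSubgroup.1 ht ‖t‖ hpos).and h).exists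
  have h1 : ‖s‖ ≤ 4 := by
    have := norm_add_le (s - t) t
    rw [sub_add_cancel] at this
    linarith
  rw [hj s hsΛ h1, zero_sub, norm_neg] at hs
  exact lt_irrefl _ hs

lemma exists_norm_le_two_of_mem_limitSubgroup {U : Filter I}
    {Λ : I → AddSubgroup ((Fin k → ℝ) × G)} {T : Finset G}
    (hT : ∀ g ∈ T, ∃ t, ‖t‖ ≤ 1 ∧ (t, g) ∈ limitSubgroup U Λ) :
    ∀ᶠ j in U, ∀ g ∈ T, ∃ t, ‖t‖ ≤ 2 ∧ (t, g) ∈ Λ j := by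
  rw [Filter.eventually_all_finset]
  intro g hg
  obtain ⟨t, ht, htΛ⟩ := hT g hg
  filter_upwards [mem_limitSubgroup.1 htΛ 1 one_pos] with j hj
  obtain ⟨s, hs, hsΛ⟩ := hj
  refine ⟨s, ?_, hsΛ⟩
  have := norm_add_le (s - t) t
  rw [sub_add_cancel] at this
  linarith

end UltrafilterLimit

/-! ### From finite to finitely generated groups. -/

section FinitelyGenerated

open Finset Filter

variable {G : Type*} [AddCommGroup G]

/-- Residual finiteness, read off a nonzero coordinate in the structure theorem. An integer `a ≠ 0`
survives modulo `|a| + 1`. -/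
lemma exists_finiteIndex_notMem [AddGroup.FG G] {g : G} (hg : g ≠ 0) :
    ∃ H : AddSubgroup G, H.FiniteIndex ∧ g ∉ H := by
  suffices h : ∃ (m : ℕ) (f : G →+ ZMod m), m ≠ 0 ∧ f g ≠ 0 by
    obtain ⟨m, f, hm, hf⟩ := h
    have : NeZero m := ⟨hm⟩
    exact ⟨f.ker, AddSubgroup.finiteIndex_ker f, by simpa using hf⟩
  obtain ⟨n, ι, _, p, hp, e, ⟨E⟩⟩ := AddCommGroup.equiv_free_prod_directSum_zmod G
  by_cases h1 : (E g).1 = 0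
  · have h2 : (E g).2 ≠ 0 := by
      intro h2
      exact hg (E.map_eq_zero_iff.1 (Prod.ext h1 h2))
    obtain ⟨i, hi⟩ := DFunLike.ne_iff.1 h2
    refine ⟨p i ^ e i, ((DFinsupp.evalAddMonoidHom i).comp
      (AddMonoidHom.snd (Fin n →₀ ℤ) _)).comp E.toAddMonoidHom, ?_, hi⟩
    exact pow_ne_zero _ (hp i).ne_zero
  · obtain ⟨i, hi⟩ := DFunLike.ne_iff.1 h1
    refine ⟨((E g).1 i).natAbs + 1, ((Int.castAddHom (ZMod (((E g).1 i).natAbs + 1))).comp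
      ((Finsupp.applyAddHom i).comp (AddMonoidHom.fst (Fin n →₀ ℤ) _))).comp E.toAddMonoidHom,
      by omega, ?_⟩
    change (((E g).1 i : ℤ) : ZMod (((E g).1 i).natAbs + 1)) ≠ 0
    intro h0
    rw [ZMod.intCast_zmod_eq_zero_iff_dvd] at h0
    have h3 := Int.natAbs_dvd_natAbs.2 h0
    have h4 := Nat.le_of_dvd (Int.natAbs_pos.2 hi) h3
    rw [Int.natAbs_natCast] at h4
    omega

lemma exists_finiteIndex_injOn [AddGroup.FG G] (T : Finset G) :
    ∃ H : AddSubgroup G, H.FiniteIndex ∧ Set.InjOn (QuotientAddGroup.mk' H) T := by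
  classical
  have h : ∀ g : G, ∃ H : AddSubgroup G, H.FiniteIndex ∧ (g ≠ 0 → g ∉ H) := by
    intro g
    by_cases hg : g = 0
    · exact ⟨⊤, inferInstance, fun h => absurd hg h⟩
    · obtain ⟨H, hH, hgH⟩ := exists_finiteIndex_notMem hg
      exact ⟨H, hH, fun _ => hgH⟩
  choose H hH hgH using h
  refine ⟨⨅ p : T × T, H (p.1 - p.2), AddSubgroup.finiteIndex_iInf fun p => hH _, ?_⟩
  intro x hx y hy hxy
  by_contra hne
  rw [QuotientAddGroup.mk'_eq_mk'] at hxy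
  obtain ⟨z, hz, hxz⟩ := hxy
  have h1 := AddSubgroup.mem_iInf.1 hz (⟨y, hy⟩, ⟨x, hx⟩)
  have h2 : y - x = z := by rw [← hxz]; abel
  refine hgH (y - x) (sub_ne_zero.2 (Ne.symm hne)) ?_
  simpa [h2] using h1

/-- The structure of sets of relative polynomial growth in finitely generated groups. -/
lemma exists_addSubgroup_of_fg [AddGroup.FG G] [DecidableEq G]
    {X : Finset G} (hX : X.Nonempty) {d : ℝ} {N : ℕ} (hN : 4 ≤ N) (hd0 : 0 ≤ d) (hd : d ≤ N)
    (hgrowth : ∀ n : ℕ, 1 ≤ n → (#(n • X) : ℝ) ≤ (n : ℝ) ^ d * #X) :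
    ∃ k < 23 * N, ∃ Λ : AddSubgroup ((Fin k → ℝ) × G),
      (∀ x ∈ X, ∀ y ∈ X, ∃ t, ‖t‖ ≤ 1 ∧ (t, x - y) ∈ Λ) ∧
      (∀ t, (t, (0 : G)) ∈ Λ → ‖t‖ ≤ 2 → t = 0) ∧
      ∀ T : Finset G, (∀ g ∈ T, ∃ t, ‖t‖ ≤ 1 ∧ (t, g) ∈ Λ) →
        (#T : ℝ) ≤ 16 * ((N : ℝ) ^ 22) ^ d * #X := by
  classical
  -- The size bound is restricted to subsets of `T`, where the finite quotient is injective; `T`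
  -- then grows along the ultrafilter.
  let P : (k : ℕ) → AddSubgroup ((Fin k → ℝ) × G) → Finset G → Prop := fun k Λ T =>
    (∀ x ∈ X, ∀ y ∈ X, ∃ t, ‖t‖ ≤ 1 ∧ (t, x - y) ∈ Λ) ∧
      (∀ t, (t, (0 : G)) ∈ Λ → ‖t‖ ≤ 4 → t = 0) ∧
      ∀ S ⊆ T, (∀ g ∈ S, ∃ t, ‖t‖ ≤ 2 ∧ (t, g) ∈ Λ) →
        (#S : ℝ) ≤ 16 * ((N : ℝ) ^ 22) ^ d * #X
  have hP : ∀ T : Finset G, ∃ k ∈ Set.Iio (23 * N), ∃ Λ, P k Λ T := by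
    intro T
    obtain ⟨H, hH, hinj⟩ := exists_finiteIndex_injOn (T ∪ X)
    set π := QuotientAddGroup.mk' H
    have hXinj : Set.InjOn π X := hinj.mono (by simp)
    have hTinj : Set.InjOn π T := hinj.mono (by simp)
    have hcardX : #(X.image π) = #X := Finset.card_image_of_injOn hXinj
    obtain ⟨k, hk, Λ, h1, h2, h3⟩ := exists_addSubgroup_of_finite (hX.image π) hN hd0 hd (by
      intro n hn
      rw [hcardX, ← Finset.image_nsmul]
      refine le_trans ?_ (hgrowth n hn)
      exact_mod_cast Finset.card_image_le)
    refine ⟨k, hk, Λ.comap ((AddMonoidHom.id _).prodMap π), ?_, ?_, ?_⟩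
    · intro x hx y hy
      obtain ⟨t, ht, htΛ⟩ := h1 (π x) (Finset.mem_image_of_mem _ hx) (π y)
        (Finset.mem_image_of_mem _ hy)
      refine ⟨t, ht, ?_⟩
      change (t, π (x - y)) ∈ Λ
      rwa [map_sub]
    · intro t ht ht4
      refine h2 t ?_ ht4
      have : (t, π 0) ∈ Λ := ht
      rwa [map_zero] at this
    · intro S hS hSΛ
      have h4 := h3 (S.image π) (by
        intro g hg
        obtain ⟨s, hs, rfl⟩ := Finset.mem_image.1 hg
        exact hSΛ s hs)
      rwa [Finset.card_image_of_injOn (hTinj.mono (by exact_mod_cast hS)), hcardX] at h4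
  let U : Ultrafilter (Finset G) := Ultrafilter.of atTop
  have hU : ∀ T : Finset G, ∀ᶠ S in (U : Filter (Finset G)), T ⊆ S := fun T =>
    Ultrafilter.of_le atTop (Filter.eventually_ge_atTop T)
  have huniv : (⋃ k ∈ Set.Iio (23 * N), {T | ∃ Λ, P k Λ T}) ∈ U := by
    refine Filter.mem_of_superset Filter.univ_mem fun T _ => ?_
    simpa using hP T
  -- Only finitely many dimensions occur, so a single `k` serves for almost all `T`.
  obtain ⟨k, hk, hkU⟩ := (Ultrafilter.finite_biUnion_mem_iff (Set.finite_Iio _)).1 huniv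
  have hex : ∀ T, ∃ Λ, (∃ Λ, P k Λ T) → P k Λ T := by
    intro T
    by_cases h : ∃ Λ, P k Λ T
    · exact ⟨h.choose, fun _ => h.choose_spec⟩
    · exact ⟨⊥, fun h' => absurd h' h⟩
  choose Λ hΛ using hex
  have hΛU : ∀ᶠ T in (U : Filter (Finset G)), P k (Λ T) T := by
    filter_upwards [hkU] with T hT using hΛ T hT
  refine ⟨k, hk, limitSubgroup U Λ, ?_, ?_, ?_⟩
  · intro x hx y hy
    exact exists_mem_limitSubgroup U (hΛU.mono fun T hT => hT.1 x hx y hy)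
  · intro t ht ht2
    exact eq_zero_of_mem_limitSubgroup (hΛU.mono fun T hT => hT.2.1) ht ht2
  · intro T hT
    obtain ⟨S, hS1, hS2, hS3⟩ :=
      ((exists_norm_le_two_of_mem_limitSubgroup hT).and ((hU T).and hΛU)).exists
    exact hS3.2.2 T hS2 hS1

end FinitelyGenerated

/-! ### From subgroups of `ℝ ^ k × G` to coset progressions. -/

section Progressions

open Finset

variable {G : Type*} [AddCommGroup G]

/-- The elements of `G` that correspond to points of the unit cube form a convex coset
progression. -/
lemma isCentredConvexCosetProgression_of_addSubgroup {k : ℕ}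
    {Λ : AddSubgroup ((Fin k → ℝ) × G)} {K : ℝ}
    (hinj : ∀ t, (t, (0 : G)) ∈ Λ → ‖t‖ ≤ 2 → t = 0)
    (hcard : ∀ T : Finset G, (∀ g ∈ T, ∃ t, ‖t‖ ≤ 1 ∧ (t, g) ∈ Λ) → (#T : ℝ) ≤ K) :
    ∃ k' ≤ k, IsCentredConvexCosetProgression k' {g : G | ∃ t, ‖t‖ ≤ 1 ∧ (t, g) ∈ Λ} ∧
      {g : G | ∃ t, ‖t‖ ≤ 1 ∧ (t, g) ∈ Λ}.Finite ∧
      ({g : G | ∃ t, ‖t‖ ≤ 1 ∧ (t, g) ∈ Λ}.ncard : ℝ) ≤ K := by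
  classical
  set M : Set G := {g : G | ∃ t, ‖t‖ ≤ 1 ∧ (t, g) ∈ Λ} with hM
  have hMfin : M.Finite := by
    by_contra hinf
    obtain ⟨n, hn⟩ := exists_nat_gt K
    obtain ⟨T, hT, hTn⟩ := Set.Infinite.exists_subset_card_eq hinf n
    have := hcard T fun g hg => hT hg
    rw [hTn] at this
    linarith
  have hMcard : (M.ncard : ℝ) ≤ K := by
    rw [Set.ncard_eq_toFinset_card M hMfin]
    exact hcard _ fun g hg => (hMfin.mem_toFinset.1 hg)
  let L : Submodule ℤ (Fin k → ℝ) :=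
    AddSubgroup.toIntSubmodule (Λ.map (AddMonoidHom.fst (Fin k → ℝ) G))
  have hL : ∀ z, z ∈ L ↔ ∃ g, (z, g) ∈ Λ := by
    intro z
    constructor
    · rintro ⟨⟨z', g⟩, h, rfl⟩
      exact ⟨g, h⟩
    · rintro ⟨g, h⟩
      exact ⟨(z, g), h, rfl⟩
  obtain ⟨n, hn⟩ := exists_nat_gt K
  -- A nonzero `z` shorter than `1 / (n + 1)` over `g` would put the `n + 1 > K` distinct elements
  -- `0, g, ..., n g` over the unit cube.
  have hdisc : DiscreteTopology L := by
    refine discreteTopology_of_forall_norm_lt (δ := 1 / ((n : ℝ) + 1)) (by positivity) ?_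
    intro z hz hzδ
    obtain ⟨g, hg⟩ := (hL z).1 hz
    by_contra hne
    have hsmall : ∀ i ∈ range (n + 1), ‖i • z‖ ≤ 1 := by
      intro i hi
      have hi' : (i : ℝ) ≤ n + 1 := by
        exact_mod_cast (Finset.mem_range.1 hi).le
      rw [← Nat.cast_smul_eq_nsmul ℝ, norm_smul, Real.norm_natCast]
      rw [lt_div_iff₀ (by positivity)] at hzδ
      nlinarith [norm_nonneg z]
    have h1 : Set.InjOn (fun i : ℕ => i • g) (range (n + 1)) := by
      intro i hi j hj hij
      have h2 := Λ.sub_mem (Λ.nsmul_mem hg i) (Λ.nsmul_mem hg j)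
      rw [Prod.smul_mk, Prod.smul_mk, Prod.mk_sub_mk, show i • g = j • g from hij, sub_self] at h2
      have h3 := hinj _ h2 ((norm_sub_le _ _).trans
        (by linarith [hsmall i (by exact_mod_cast hi), hsmall j (by exact_mod_cast hj)]))
      rw [← Nat.cast_smul_eq_nsmul ℝ, ← Nat.cast_smul_eq_nsmul ℝ, ← sub_smul, smul_eq_zero] at h3
      exact_mod_cast sub_eq_zero.1 (h3.resolve_right hne)
    have h2 := hcard ((range (n + 1)).image fun i => i • g) (by
      intro x hx
      obtain ⟨i, hi, rfl⟩ := Finset.mem_image.1 hx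
      exact ⟨i • z, hsmall i hi, Λ.nsmul_mem hg i⟩)
    rw [Finset.card_image_of_injOn h1, Finset.card_range] at h2
    push_cast at h2
    linarith
  let k' := Module.finrank ℤ L
  let b : Module.Basis (Fin k') ℤ L := Module.finBasis ℤ L
  let v : Fin k' → (Fin k → ℝ) := fun i => b i
  have hspan : Submodule.span ℤ (Set.range v) = L := by
    have h1 : Set.range v = L.subtype '' Set.range b := by
      rw [← Set.range_comp]; rfl
    rw [h1, Submodule.span_image, b.span_eq, Submodule.map_top, Submodule.range_subtype]
  -- Discreteness upgrades integral to real independence, so `σ` is injective and the preimage of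
  -- the cube is compact.
  have hv : LinearIndependent ℝ v := by
    rw [linearIndependent_iff_card_eq_finrank_span,
      Real.finrank_eq_int_finrank_of_discrete (by rw [hspan]; exact hdisc), Set.finrank, hspan]
    simp [k']
  have hk' : k' ≤ k := by simpa using hv.fintype_card_le_finrank
  have hvΛ : ∀ i, ∃ g, (v i, g) ∈ Λ := fun i => (hL _).1 (b i).2
  choose γ hγ using hvΛ
  let σ : (Fin k' → ℝ) →ₗ[ℝ] (Fin k → ℝ) := Fintype.linearCombination ℝ v
  have hσ : ∀ s, σ s = ∑ i, s i • v i := fun s => Fintype.linearCombination_apply ℝ v s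
  have hσinj : LinearMap.ker σ = ⊥ := by
    rw [LinearMap.ker_eq_bot']
    intro s hs
    rw [hσ] at hs
    funext i
    exact Fintype.linearIndependent_iff.1 hv s hs i
  have hemb := LinearMap.isClosedEmbedding_of_injective hσinj
  let Q : ConvexBody (Fin k' → ℝ) :=
    { carrier := σ ⁻¹' Metric.closedBall 0 1
      convex' := (convex_closedBall _ _).linear_preimage σ
      isCompact' := hemb.isCompact_preimage (isCompact_closedBall _ _)
      nonempty' := ⟨0, by simp⟩ }
  have hQ : ∀ s, s ∈ Q ↔ ‖σ s‖ ≤ 1 := fun s => mem_closedBall_zero_iff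
  let φ : (Fin k' → ℤ) →+ G := (Fintype.linearCombination ℤ γ).toAddMonoidHom
  have hφ : ∀ z, φ z = ∑ i, z i • γ i := fun z => Fintype.linearCombination_apply ℤ γ z
  have hφΛ : ∀ z : Fin k' → ℤ, (σ (fun i => (z i : ℝ)), φ z) ∈ Λ := by
    intro z
    have h1 : (σ (fun i => (z i : ℝ)), φ z) = ∑ i, z i • (v i, γ i) := by
      rw [hσ, hφ]
      refine Prod.ext ?_ ?_
      · simp only [Prod.fst_sum, Prod.smul_fst, Int.cast_smul_eq_zsmul]
      · simp only [Prod.snd_sum, Prod.smul_snd]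
    rw [h1]
    exact Λ.sum_mem fun i _ => Λ.zsmul_mem (hγ i) _
  refine ⟨k', hk', ⟨_, Λ.comap (AddMonoidHom.inr _ G), ⟨Q, φ, ?_, ?_, rfl⟩, ?_⟩, hMfin, hMcard⟩
  · refine ⟨0, mem_interior.2 ⟨σ ⁻¹' Metric.ball 0 1, ?_, ?_, by simp⟩⟩
    · exact Set.preimage_mono Metric.ball_subset_closedBall
    · exact Metric.isOpen_ball.preimage hemb.continuous
  · intro s hs
    rw [hQ] at hs ⊢
    rwa [map_neg, norm_neg]
  · ext g
    rw [Set.mem_add]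
    constructor
    · rintro ⟨t, ht, htg⟩
      have htL : t ∈ L := (hL t).2 ⟨g, htg⟩
      let z : Fin k' → ℤ := fun i => b.repr ⟨t, htL⟩ i
      have hz : σ (fun i => (z i : ℝ)) = t := by
        have h1 := congrArg Subtype.val (b.sum_repr ⟨t, htL⟩)
        rw [hσ]
        simp only [Int.cast_smul_eq_zsmul]
        rw [Submodule.coe_sum] at h1
        exact h1
      refine ⟨φ z, ⟨z, ?_, rfl⟩, g - φ z, ?_, by abel⟩
      · change (fun i => (z i : ℝ)) ∈ Q
        rw [hQ, hz]; exact ht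
      · have h2 := Λ.sub_mem htg (hφΛ z)
        rw [hz, Prod.mk_sub_mk, sub_self] at h2
        exact h2
    · rintro ⟨_, ⟨z, hz, rfl⟩, h, hh, rfl⟩
      refine ⟨σ (fun i => (z i : ℝ)), (hQ _).1 hz, ?_⟩
      have h1 := Λ.add_mem (hφΛ z) (show ((0 : Fin k → ℝ), h) ∈ Λ from hh)
      rwa [Prod.mk_add_mk, add_zero] at h1

end Progressions

/-! ### Doubling below `3/2`. -/

section SmallDoubling

open Finset

variable {G : Type*} [AddCommGroup G] [DecidableEq G]

/-- A set with doubling less than `3 / 2` has as difference set a subgroup, of the size of its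
sumset. -/
lemma exists_addSubgroup_of_card_add_lt {X : Finset G} (hX : X.Nonempty)
    (h : 2 * #(X + X) < 3 * #X) :
    ∃ H : AddSubgroup G, (H : Set G) = ((X - X : Finset G) : Set G) ∧ #(X - X) ≤ #(X + X) := by
  -- Two translates of `X` inside `X + X` overlap in more than half of `X`, so every difference has
  -- more than `#X / 2` representations.
  have hpop : ∀ g ∈ X - X, #X < 2 * #(X.filter fun a => a + g ∈ X) := by
    intro g hg
    obtain ⟨x, hx, y, hy, rfl⟩ := Finset.mem_sub.1 hg
    have h1 : (x +ᵥ X) ∪ (y +ᵥ X) ⊆ X + X := by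
      refine Finset.union_subset ?_ ?_ <;> intro w hw <;>
        obtain ⟨a, ha, rfl⟩ := Finset.mem_vadd_finset.1 hw
      · exact Finset.add_mem_add hx ha
      · exact Finset.add_mem_add hy ha
    have h2 := Finset.card_le_card h1
    have h3 := Finset.card_union_add_card_inter (x +ᵥ X) (y +ᵥ X)
    rw [Finset.card_vadd_finset, Finset.card_vadd_finset] at h3
    have h4 : (x +ᵥ X) ∩ (y +ᵥ X) ⊆ (X.filter fun a => a + (x - y) ∈ X).image (x + ·) := by
      intro w hw
      obtain ⟨hw1, hw2⟩ := Finset.mem_inter.1 hw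
      obtain ⟨a, ha, rfl⟩ := Finset.mem_vadd_finset.1 hw1
      obtain ⟨b, hb, hab⟩ := Finset.mem_vadd_finset.1 hw2
      refine Finset.mem_image.2 ⟨a, Finset.mem_filter.2 ⟨ha, ?_⟩, rfl⟩
      have : a + (x - y) = b := by
        rw [vadd_eq_add, vadd_eq_add] at hab
        rw [← add_sub_assoc, add_comm a x, ← hab]; abel
      rwa [this]
    have h5 := (Finset.card_le_card h4).trans Finset.card_image_le
    omega
  have hneg : ∀ g ∈ X - X, -g ∈ X - X := by
    intro g hg
    obtain ⟨x, hx, y, hy, rfl⟩ := Finset.mem_sub.1 hg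
    rw [neg_sub]
    exact Finset.sub_mem_sub hy hx
  have hadd : ∀ g ∈ X - X, ∀ g' ∈ X - X, g + g' ∈ X - X := by
    intro g hg g' hg'
    have h1 := hpop (-g) (hneg g hg)
    have h2 := hpop g' hg'
    obtain ⟨a, haa⟩ := Finset.inter_nonempty_of_card_lt_card_add_card
      (Finset.filter_subset (fun a => a + -g ∈ X) X) (Finset.filter_subset (fun a => a + g' ∈ X) X)
      (by omega)
    obtain ⟨ha1, ha2⟩ := Finset.mem_inter.1 haa
    have h3 := Finset.sub_mem_sub (Finset.mem_filter.1 ha2).2 (Finset.mem_filter.1 ha1).2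
    have h4 : a + g' - (a + -g) = g + g' := by abel
    rwa [h4] at h3
  have hlt : #(X - X) < 2 * #X := by
    have h1 : #(X ×ˢ X) = ∑ g ∈ X - X, #((X ×ˢ X).filter fun p => p.1 - p.2 = g) :=
      Finset.card_eq_sum_card_fiberwise fun p hp =>
        Finset.sub_mem_sub (Finset.mem_product.1 hp).1 (Finset.mem_product.1 hp).2
    have h2 : ∀ g ∈ X - X, #X + 1 ≤ 2 * #((X ×ˢ X).filter fun p => p.1 - p.2 = g) := by
      intro g hg
      have h3 : #(X.filter fun a => a + g ∈ X) ≤ #((X ×ˢ X).filter fun p => p.1 - p.2 = g) := by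
        refine Finset.card_le_card_of_injOn (fun a => (a + g, a)) ?_ ?_
        · intro a ha
          obtain ⟨ha1, ha2⟩ := Finset.mem_filter.1 ha
          exact Finset.mem_filter.2 ⟨Finset.mem_product.2 ⟨ha2, ha1⟩, by simp⟩
        · intro a _ b _ hab
          exact (Prod.ext_iff.1 hab).2
      have := hpop g hg
      omega
    have h3 := Finset.sum_le_sum h2
    rw [← Finset.mul_sum, ← h1, Finset.card_product, Finset.sum_const, smul_eq_mul] at h3
    have := hX.card_pos
    by_contra! hcon
    nlinarith
  obtain ⟨x₀, hx₀⟩ := hX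
  refine ⟨{ carrier := ((X - X : Finset G) : Set G)
            zero_mem' := by
              have := Finset.sub_mem_sub hx₀ hx₀
              rw [sub_self] at this
              exact_mod_cast this
            add_mem' := fun {a b} ha hb => hadd a ha b hb
            neg_mem' := fun {a} ha => hneg a ha }, rfl, ?_⟩
  -- `X` and `2x₀ + g - X` both lie in the coset of `x₀`, which has fewer than `2 #X` points; a
  -- common point writes `2x₀ + g` as a sum of two elements of `X`.
  refine Finset.card_le_card_of_injOn (fun h => x₀ + x₀ + h) ?_ (fun a _ b _ hab => by
    simpa using hab)
  intro g hg
  have h1 : X ⊆ x₀ +ᵥ (X - X) := by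
    intro a ha
    exact Finset.mem_vadd_finset.2 ⟨a - x₀, Finset.sub_mem_sub ha hx₀, by simp⟩
  have h2 : X.image (fun a => x₀ + x₀ + g - a) ⊆ x₀ +ᵥ (X - X) := by
    intro w hw
    obtain ⟨a, ha, rfl⟩ := Finset.mem_image.1 hw
    refine Finset.mem_vadd_finset.2 ⟨(x₀ - a) + g, hadd _ (Finset.sub_mem_sub hx₀ ha) _ hg, ?_⟩
    rw [vadd_eq_add]; abel
  obtain ⟨w, hw⟩ := Finset.inter_nonempty_of_card_lt_card_add_card h1 h2 (by
    rw [Finset.card_vadd_finset, Finset.card_image_of_injective _ sub_right_injective]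
    omega)
  obtain ⟨hw1, hw2⟩ := Finset.mem_inter.1 hw
  obtain ⟨a, ha, rfl⟩ := Finset.mem_image.1 hw2
  have h3 := Finset.add_mem_add hw1 ha
  rw [sub_add_cancel] at h3
  exact h3

end SmallDoubling

/-! ### General groups and the final constants. -/

section Main

open Finset

lemma iteratedSumset_coe {G : Type*} [AddCommGroup G] [DecidableEq G] (n : ℕ) (X : Finset G) :
    iteratedSumset n (X : Set G) = ((n • X : Finset G) : Set G) := by
  ext x
  rw [Finset.coe_nsmul, Set.mem_nsmul]
  constructor
  · rintro ⟨f, hf, rfl⟩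
    exact ⟨fun i => ⟨f i, hf i⟩, by rw [List.sum_ofFn]⟩
  · rintro ⟨f, rfl⟩
    exact ⟨fun i => f i, fun i => (f i).2, by rw [List.sum_ofFn]⟩

/-- The structure of sets of relative polynomial growth in arbitrary abelian groups. -/
lemma exists_addSubgroup_of_growth {G : Type*} [AddCommGroup G] [DecidableEq G]
    {X : Finset G} (hX : X.Nonempty) {d : ℝ} {N : ℕ} (hN : 4 ≤ N) (hd0 : 0 ≤ d) (hd : d ≤ N)
    (hgrowth : ∀ n : ℕ, 1 ≤ n → (#(n • X) : ℝ) ≤ (n : ℝ) ^ d * #X) :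
    ∃ k < 23 * N, ∃ Λ : AddSubgroup ((Fin k → ℝ) × G),
      (∀ x ∈ X, ∀ y ∈ X, ∃ t, ‖t‖ ≤ 1 ∧ (t, x - y) ∈ Λ) ∧
      (∀ t, (t, (0 : G)) ∈ Λ → ‖t‖ ≤ 2 → t = 0) ∧
      ∀ T : Finset G, (∀ g ∈ T, ∃ t, ‖t‖ ≤ 1 ∧ (t, g) ∈ Λ) →
        (#T : ℝ) ≤ 16 * ((N : ℝ) ^ 22) ^ d * #X := by
  classical
  let G₀ := AddSubgroup.closure (X : Set G)
  have hfg : AddGroup.FG G₀ :=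
    (AddGroup.fg_iff_addSubgroup_fg G₀).2 ⟨X, rfl⟩
  have hsub : ∀ x ∈ X, x ∈ G₀ := fun x hx => AddSubgroup.subset_closure hx
  let Y : Finset G₀ := X.subtype (· ∈ G₀)
  have hYX : Y.image G₀.subtype = X := by
    ext x
    simp only [Y, Finset.mem_image, Finset.mem_subtype, AddSubgroup.coe_subtype]
    constructor
    · rintro ⟨y, hy, rfl⟩
      exact hy
    · intro hx
      exact ⟨⟨x, hsub x hx⟩, hx, rfl⟩
  have hcard : ∀ S : Finset G₀, #(S.image G₀.subtype) = #S := fun S =>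
    Finset.card_image_of_injective _ Subtype.coe_injective
  have hY : Y.Nonempty := by rwa [← Finset.image_nonempty (f := G₀.subtype), hYX]
  obtain ⟨k, hk, Λ, h1, h2, h3⟩ := exists_addSubgroup_of_fg hY hN hd0 hd (by
    intro n hn
    rw [← hcard Y, ← hcard, Finset.image_nsmul, hYX]
    exact hgrowth n hn)
  have hmem : ∀ t g, (t, g) ∈ Λ.map ((AddMonoidHom.id (Fin k → ℝ)).prodMap G₀.subtype) ↔
      ∃ g' : G₀, (g' : G) = g ∧ (t, g') ∈ Λ := by
    intro t g
    constructor
    · rintro ⟨⟨t', g'⟩, h, hg⟩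
      obtain ⟨rfl, rfl⟩ := Prod.ext_iff.1 hg
      exact ⟨g', rfl, h⟩
    · rintro ⟨g', rfl, h⟩
      exact ⟨(t, g'), h, rfl⟩
  refine ⟨k, hk, Λ.map ((AddMonoidHom.id _).prodMap G₀.subtype), ?_, ?_, ?_⟩
  · intro x hx y hy
    obtain ⟨t, ht, htΛ⟩ := h1 ⟨x, hsub x hx⟩ (Finset.mem_subtype.2 hx) ⟨y, hsub y hy⟩
      (Finset.mem_subtype.2 hy)
    exact ⟨t, ht, (hmem _ _).2 ⟨_, rfl, htΛ⟩⟩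
  · intro t ht ht2
    obtain ⟨g, hg, hgΛ⟩ := (hmem _ _).1 ht
    have hg0 : g = 0 := Subtype.ext hg
    rw [hg0] at hgΛ
    exact h2 t hgΛ ht2
  · intro T hT
    have h4 : ∀ g ∈ T, g ∈ G₀ := by
      intro g hg
      obtain ⟨t, -, ht⟩ := hT g hg
      obtain ⟨g', rfl, -⟩ := (hmem _ _).1 ht
      exact g'.2
    have h5 : #(T.subtype (· ∈ G₀)) = #T := by
      rw [Finset.card_subtype, Finset.filter_true_of_mem h4]
    have h6 := h3 (T.subtype (· ∈ G₀)) (by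
      intro g hg
      obtain ⟨t, ht, htΛ⟩ := hT g (Finset.mem_subtype.1 hg)
      obtain ⟨g', hg', hΛ⟩ := (hmem _ _).1 htΛ
      rw [Subtype.ext hg'] at hΛ
      exact ⟨t, ht, hΛ⟩)
    rwa [h5, ← hcard Y, hYX] at h6

/-- Sets of relative polynomial growth of small order are dense in cosets of subgroups. -/
lemma exists_addSubgroup_of_growth_lt_half {G : Type*} [AddCommGroup G] [DecidableEq G]
    {X : Finset G} (hX : X.Nonempty) {d : ℝ} (hd : d < 1 / 2)
    (hgrowth : (#(2 • X) : ℝ) ≤ (2 : ℝ) ^ d * #X) :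
    ∃ Λ : AddSubgroup ((Fin 0 → ℝ) × G),
      (∀ x ∈ X, ∀ y ∈ X, ∃ t, ‖t‖ ≤ 1 ∧ (t, x - y) ∈ Λ) ∧
      (∀ t, (t, (0 : G)) ∈ Λ → ‖t‖ ≤ 2 → t = 0) ∧
      ∀ T : Finset G, (∀ g ∈ T, ∃ t, ‖t‖ ≤ 1 ∧ (t, g) ∈ Λ) →
        (#T : ℝ) ≤ (2 : ℝ) ^ d * #X := by
  have hX0 : (0 : ℝ) < #X := by exact_mod_cast hX.card_pos
  rw [two_nsmul] at hgrowth
  have h1 : (2 : ℝ) ^ d < 3 / 2 := by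
    calc (2 : ℝ) ^ d < 2 ^ (1 / 2 : ℝ) := Real.rpow_lt_rpow_of_exponent_lt (by norm_num) hd
      _ = √2 := (Real.sqrt_eq_rpow 2).symm
      _ < 3 / 2 := by
        rw [Real.sqrt_lt' (by norm_num)]; norm_num
  obtain ⟨H, hH, hcard⟩ := exists_addSubgroup_of_card_add_lt hX (by
    have : 2 * (#(X + X) : ℝ) < 3 * #X := by nlinarith
    exact_mod_cast this)
  have hmem : ∀ g, g ∈ H ↔ g ∈ X - X := fun g => by
    rw [← SetLike.mem_coe, hH, Finset.mem_coe]
  refine ⟨(⊥ : AddSubgroup (Fin 0 → ℝ)).prod H, ?_, fun t _ _ => Subsingleton.elim _ _, ?_⟩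
  · intro x hx y hy
    exact ⟨0, norm_zero.trans_le zero_le_one, AddSubgroup.mem_prod.2
      ⟨AddSubgroup.mem_bot.2 rfl, (hmem _).2 (Finset.sub_mem_sub hx hy)⟩⟩
  · intro T hT
    refine le_trans ?_ hgrowth
    have h2 : T ⊆ X - X := by
      intro g hg
      obtain ⟨t, -, ht⟩ := hT g hg
      exact (hmem g).1 (AddSubgroup.mem_prod.1 ht).2
    exact_mod_cast (Finset.card_le_card h2).trans hcard

theorem mainTheorem2 :
    ∃ C : ℝ, 0 < C ∧
      ∀ (G : Type*) [AddCommGroup G] (X : Set G) (d : ℝ),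
        X.Finite → X.Nonempty → 0 ≤ d → HasRelativePolynomialGrowth X d →
        ∃ (k : ℕ) (M : Set G),
          IsCentredConvexCosetProgression k M ∧
          X - X ⊆ M ∧
          (k : ℝ) ≤ C * (d * Real.log (d + 2) ^ 2) ∧
          M.Finite ∧
          (M.ncard : ℝ) ≤ Real.exp (C * (d * Real.log (d + 2) ^ 2)) * (X.ncard : ℝ) := by
  classical
  refine ⟨2000, by norm_num, ?_⟩
  intro G _ X' d hXfin hXne hd0 hgr
  obtain ⟨X, rfl⟩ := hXfin.exists_finset_coe
  have hX : X.Nonempty := by exact_mod_cast hXne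
  have hgrowth : ∀ n : ℕ, 1 ≤ n → (#(n • X) : ℝ) ≤ (n : ℝ) ^ d * #X := by
    intro n hn
    have h := hgr n hn
    rwa [iteratedSumset_coe, Set.ncard_coe_finset, Set.ncard_coe_finset] at h
  rw [Set.ncard_coe_finset]
  set ℓ := Real.log (d + 2) with hℓ
  have hlog2 := Real.log_two_gt_d9
  have hℓ2 : Real.log 2 ≤ ℓ := Real.log_le_log (by norm_num) (by linarith)
  have hℓ0 : 0.69 ≤ ℓ := by linarith
  have hℓsq : 0.69 * ℓ ≤ ℓ ^ 2 := by nlinarith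
  suffices h : ∃ (k : ℕ) (Λ : AddSubgroup ((Fin k → ℝ) × G)) (K : ℝ),
      (∀ x ∈ X, ∀ y ∈ X, ∃ t, ‖t‖ ≤ 1 ∧ (t, x - y) ∈ Λ) ∧
      (∀ t, (t, (0 : G)) ∈ Λ → ‖t‖ ≤ 2 → t = 0) ∧
      (∀ T : Finset G, (∀ g ∈ T, ∃ t, ‖t‖ ≤ 1 ∧ (t, g) ∈ Λ) → (#T : ℝ) ≤ K * #X) ∧
      (k : ℝ) ≤ 2000 * (d * ℓ ^ 2) ∧ K ≤ Real.exp (2000 * (d * ℓ ^ 2)) by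
    obtain ⟨k, Λ, K, h1, h2, h3, h4, h5⟩ := h
    obtain ⟨k', hk', hM1, hM2, hM3⟩ := isCentredConvexCosetProgression_of_addSubgroup h2 h3
    refine ⟨k', _, hM1, ?_, le_trans (by exact_mod_cast hk') h4, hM2, hM3.trans ?_⟩
    · intro g hg
      obtain ⟨x, hx, y, hy, rfl⟩ := Set.mem_sub.1 hg
      exact h1 x hx y hy
    · gcongr
  -- For small `d` the bounds force dimension `0` and cannot absorb the factor `16`. Once `d ≥ 1/2`,
  -- additive constants are multiples of `d`.
  by_cases hd : d < 1 / 2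
  · obtain ⟨Λ, h1, h2, h3⟩ := exists_addSubgroup_of_growth_lt_half hX hd
      (by simpa using hgrowth 2 (by norm_num))
    refine ⟨0, Λ, 2 ^ d, h1, h2, h3, by simp; positivity, ?_⟩
    rw [Real.rpow_def_of_pos (by norm_num)]
    apply Real.exp_le_exp.2
    have : Real.log 2 * d ≤ ℓ * d := by gcongr
    nlinarith [mul_nonneg hd0 (by linarith : (0 : ℝ) ≤ ℓ ^ 2 - 0.69 * ℓ),
      mul_nonneg hd0 (by linarith : (0 : ℝ) ≤ ℓ)]
  · push Not at hd
    have hceil : d ≤ ⌈d⌉₊ := Nat.le_ceil d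
    have hceil' : (⌈d⌉₊ : ℝ) < d + 1 := Nat.ceil_lt_add_one hd0
    obtain ⟨k, hk, Λ, h1, h2, h3⟩ := exists_addSubgroup_of_growth (N := ⌈d⌉₊ + 4) hX (by omega)
      hd0 (by push_cast; linarith) hgrowth
    have hdℓ : 0 ≤ d * (ℓ - 0.69) := mul_nonneg hd0 (by linarith)
    have hdℓ2 : 0 ≤ d * (ℓ ^ 2 - 0.69 * ℓ) := mul_nonneg hd0 (by linarith)
    refine ⟨k, Λ, _, h1, h2, h3, ?_, ?_⟩
    · have hk' : (k : ℝ) ≤ 23 * (⌈d⌉₊ + 4) := by exact_mod_cast hk.le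
      nlinarith
    · have hN : ((⌈d⌉₊ + 4 : ℕ) : ℝ) ≤ (d + 2) ^ 2 := by push_cast; nlinarith
      have hd2 : (0 : ℝ) < d + 2 := by linarith
      have hexp : d + 2 = Real.exp ℓ := (Real.exp_log hd2).symm
      have h5 : (((⌈d⌉₊ + 4 : ℕ) : ℝ) ^ 22) ^ d ≤ Real.exp (44 * ℓ * d) := by
        calc (((⌈d⌉₊ + 4 : ℕ) : ℝ) ^ 22) ^ d ≤ (((d + 2) ^ 2) ^ 22) ^ d := by gcongr
          _ = Real.exp (44 * ℓ * d) := by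
            rw [hexp, ← pow_mul, ← Real.exp_nat_mul, ← Real.exp_mul]
            norm_num
      have h6 : (16 : ℝ) ≤ Real.exp (4 * ℓ) := by
        calc (16 : ℝ) = 2 ^ 4 := by norm_num
          _ ≤ (d + 2) ^ 4 := by gcongr; linarith
          _ = Real.exp (4 * ℓ) := by
            rw [hexp, ← Real.exp_nat_mul]; norm_num
      calc 16 * (((⌈d⌉₊ + 4 : ℕ) : ℝ) ^ 22) ^ d ≤ Real.exp (4 * ℓ) * Real.exp (44 * ℓ * d) := by
            gcongr
        _ = Real.exp (4 * ℓ + 44 * ℓ * d) := (Real.exp_add _ _).symm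
        _ ≤ _ := by
          gcongr
          nlinarith [mul_nonneg (by linarith : (0 : ℝ) ≤ d - 1 / 2) (by linarith : (0 : ℝ) ≤ ℓ)]

end Main
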